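/- **Theorem (second Calderón formula for Weinstein multipliers).** Let $d\in\mathbb N$, $\alpha>-1/2$, $\mathbb R^{d+1}_+=\mathbb R^d\times(0,\infty)$, write $x=(x',x_{d+1})$, $-x=(-x',x_{d+1})$, and let $$d\mu_\alpha(x)=\frac{x_{d+1}^{2\alpha+1}}{(2\pi)^{d/2}2^{\alpha}\Gamma(\alpha+1)}\,dx,\qquad L^p_\alpha=L^p(\mathbb R^{d+1}_+,\mu_\alpha;\mathbb C),\qquad \|f\|_{\alpha,p}=\|f\|_{L^p_\alpha}.$$ Let $j_\alpha(t)=\Gamma(\alpha+1)\sum_{k\ge0}\frac{(-1)^k(t/2)^{2k}}{k!\,\Gamma(\alpha+k+1)}$ and $\Lambda_\alpha(\lambda,x)=e^{-i\langle x',\lambda'\rangle}j_\alpha(x_{d+1}\lambda_{d+1})$. Let $\mathcal F_{W,\alpha}$ be the Weinstein transform on $L^2_\alpha$, i.e. the unique isometric isomorphism of $L^2_\alpha$ with $\mathcal F_{W,\alpha}f(\lambda)=\int_{\mathbb R^{d+1}_+} f(x)\Lambda_\alpha(\lambda,x)\,d\mu_\alpha(x)$ for $f\in L^1_\alpha\cap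 L^2_\alpha$, and let $\mathcal F_{W,\alpha}^{-1}$ be its inverse. For $f,g\in L^2_\alpha$ and $x\in\mathbb R^{d+1}_+$ put $$\tau_xf(y)=\frac{\Gamma(\alpha+1)}{\sqrt\pi\,\Gamma(\alpha+\frac12)}\int_0^\pi f\Big(x'+y',\sqrt{x_{d+1}^2+y_{d+1}^2+2x_{d+1}y_{d+1}\cos\theta}\Big)(\sin\theta)^{2\alpha}\,d\theta,$$ $$(f*_Wg)(x)=\int_{\mathbb R^{d+1}_+}\tau_xf(-y)\,g(y)\,d\mu_\alpha(y).$$ Let $\varphi\in L^2_\alpha$ and let $m\in L^2_\alpha\cap L^\infty_\alpha$ be admissible: with $m_\sigma(x)=m(\sigma x)$, $$\int_0^\infty|m_\sigma(x)|^2\,\frac{d\sigma}{\sigma}=1\qquad\text{for a.e. }x\in\mathbb R^{d+1}_+ .$$ For $\sigma>0$ let $\mathcal T_{w,m,\sigma}\varphi=\mathcal F_{W,\alpha}^{-1}(m_\sigma\,\mathcal F_{W,\alpha}\varphi)$. Then for all $0<\gamma<\delta<\infty$ the integrals defining $$\varphi_{\gamma,\delta}(x)=\int_\gamma^\delta\big(\mathcal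 T_{w,m,\sigma}\varphi*_W\mathcal F_{W,\alpha}^{-1}(\overline{m_\sigma})\big)(x)\,\frac{d\sigma}{\sigma}$$ converge absolutely for every $x\in\mathbb R^{d+1}_+$ (the inner integral over $\theta$ for a.e. $y$), the function $\varphi_{\gamma,\delta}$ belongs to $L^2_\alpha$, and $$\lim_{(\gamma,\delta)\to(0,\infty)}\|\varphi_{\gamma,\delta}-\varphi\|_{\alpha,2}=0 .$$ -/

import Mathlib

open MeasureTheory Filter Topology
open scoped ENNReal

noncomputable section

namespace Weinstein

/-- The ambient space `ℝᵈ × ℝ`. The half space `ℝ₊^{d+1} = ℝᵈ × (0, ∞)` is the set of its points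
with positive last coordinate, and `mu` below is carried by that set. -/
abbrev Space (d : ℕ) : Type := EuclideanSpace ℝ (Fin d) × ℝ

/-- `dμ_α(x) = x_{d+1}^{2α+1} / ((2π)^{d/2} 2^α Γ(α+1)) dx` on `ℝᵈ × (0, ∞)`. -/
def mu (d : ℕ) (α : ℝ) : Measure (Space d) :=
  ((volume : Measure (Space d)).restrict {x | 0 < x.2}).withDensity fun x =>
    ENNReal.ofReal (x.2 ^ (2 * α + 1) /
      ((2 * Real.pi) ^ ((d : ℝ) / 2) * (2 : ℝ) ^ α * Real.Gamma (α + 1)))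

/-- The normalized Bessel function
`j_α(t) = Γ(α+1) ∑ₖ (-1)ᵏ (t/2)^{2k} / (k! Γ(α+k+1))`. -/
def besselj (α t : ℝ) : ℝ :=
  Real.Gamma (α + 1) *
    ∑' k : ℕ, (-1) ^ k * (t / 2) ^ (2 * k) / (k.factorial * Real.Gamma (α + k + 1))

/-- The Weinstein kernel `Λ_α(l, x) = exp(-i⟨x', l'⟩) j_α(x_{d+1} l_{d+1})`. -/
def kernel {d : ℕ} (α : ℝ) (l x : Space d) : ℂ :=
  Complex.exp (-Complex.I * ((inner ℝ x.1 l.1 : ℝ) : ℂ)) * (besselj α (x.2 * l.2) : ℂ)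

/-- The Weinstein transform of an integrable function. -/
def transform {d : ℕ} (α : ℝ) (f : Space d → ℂ) (l : Space d) : ℂ :=
  ∫ x, f x * kernel α l x ∂(mu d α)

/-- The Hilbert space `L²_α`. -/
abbrev L2 (d : ℕ) (α : ℝ) : Type := Lp ℂ 2 (mu d α)

/-- The class in `L²_α` of a square integrable function (`0` for any other function). -/
def toL2 {d : ℕ} (α : ℝ) (f : Space d → ℂ) : L2 d α := by
  classical exact if h : MemLp f 2 (mu d α) then h.toLp f else 0

/-- `W` is an isometric isomorphism of `L²_α` that agrees with the integral transform on
`L¹_α ∩ L²_α`. -/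
def IsPlancherelExtension (d : ℕ) (α : ℝ) (W : L2 d α ≃ₗᵢ[ℂ] L2 d α) : Prop :=
  ∀ f : L2 d α, MemLp f 1 (mu d α) → W f =ᵐ[mu d α] transform α f

/-- There is at most one such extension. -/
theorem IsPlancherelExtension.unique {d : ℕ} {α : ℝ} {V W : L2 d α ≃ₗᵢ[ℂ] L2 d α}
    (hV : IsPlancherelExtension d α V) (hW : IsPlancherelExtension d α W) : V = W := by
  have key : (V : L2 d α → L2 d α) = W := by
    refine (Lp.simpleFunc.denseRange (E := ℂ) (μ := mu d α) (p := 2) (by simp)).equalizer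
      V.continuous W.continuous (funext fun s => ?_)
    have h1 : MemLp (s : L2 d α) 1 (mu d α) := by
      have hs : MemLp (Lp.simpleFunc.toSimpleFunc s) 2 (mu d α) := Lp.simpleFunc.memLp s
      have hi : MemLp (Lp.simpleFunc.toSimpleFunc s) 1 (mu d α) :=
        (SimpleFunc.memLp_iff (by simp) (by simp)).2
          ((SimpleFunc.memLp_iff (by simp) (by simp)).1 hs)
      exact hi.ae_eq (Lp.simpleFunc.toSimpleFunc_eq_toFun s)
    exact Lp.ext ((hV _ h1).trans (hW _ h1).symm)
  exact LinearIsometryEquiv.ext fun x => congrFun key x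

/-- The Weinstein transform on `L²_α`: the isometric isomorphism extending the integral transform
(unique by `IsPlancherelExtension.unique`; that it exists is Plancherel's theorem). Its inverse
`(transformL2 d α).symm` is the inverse transform `F_{W,α}⁻¹`. -/
def transformL2 (d : ℕ) (α : ℝ) : L2 d α ≃ₗᵢ[ℂ] L2 d α :=
  have : Nonempty (L2 d α ≃ₗᵢ[ℂ] L2 d α) := ⟨LinearIsometryEquiv.refl ℂ _⟩
  Classical.epsilon (IsPlancherelExtension d α)

/-- `-y = (-y', y_{d+1})`. -/
def reflect {d : ℕ} (y : Space d) : Space d := (-y.1, y.2)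

/-- The integrand, in `θ ∈ (0, π)`, of the generalized translation `τ_x f(y)`. -/
def translationIntegrand {d : ℕ} (α : ℝ) (x : Space d) (f : Space d → ℂ) (y : Space d)
    (θ : ℝ) : ℂ :=
  f (x.1 + y.1, Real.sqrt (x.2 ^ 2 + y.2 ^ 2 + 2 * x.2 * y.2 * Real.cos θ)) *
    ((Real.sin θ ^ (2 * α) : ℝ) : ℂ)

/-- The generalized translation
`τ_x f(y) = C_α ∫₀^π f(x' + y', √(x_{d+1}² + y_{d+1}² + 2 x_{d+1} y_{d+1} cos θ)) (sin θ)^{2α} dθ`,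
`C_α = Γ(α+1) / (√π Γ(α+1/2))`. -/
def translation {d : ℕ} (α : ℝ) (x : Space d) (f : Space d → ℂ) (y : Space d) : ℂ :=
  ((Real.Gamma (α + 1) / (Real.sqrt Real.pi * Real.Gamma (α + 1 / 2)) : ℝ) : ℂ) *
    ∫ θ in (0 : ℝ)..Real.pi, translationIntegrand α x f y θ

/-- The generalized convolution `(f * g)(x) = ∫ τ_x f(-y) g(y) dμ_α(y)`. -/
def conv {d : ℕ} (α : ℝ) (f g : Space d → ℂ) (x : Space d) : ℂ :=
  ∫ y, translation α x f (reflect y) * g y ∂(mu d α)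

/-- The integrals defining `(f * g)(x)` converge absolutely. -/
def ConvConvergesAt {d : ℕ} (α : ℝ) (f g : Space d → ℂ) (x : Space d) : Prop :=
  (∀ᵐ y ∂(mu d α),
    IntervalIntegrable (translationIntegrand α x f (reflect y)) volume 0 Real.pi) ∧
  Integrable (fun y => translation α x f (reflect y) * g y) (mu d α)

/-- `m_σ(x) = m(σ x)`. -/
def dilate {d : ℕ} (m : Space d → ℂ) (σ : ℝ) (x : Space d) : ℂ := m (σ • x)

/-- The multiplier operator `T_{w,m,σ} φ = F⁻¹(m_σ F φ)`. -/
def multiplierOp {d : ℕ} (α : ℝ) (m : Space d → ℂ) (σ : ℝ) (φ : Space d → ℂ) : L2 d α :=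
  (transformL2 d α).symm (toL2 α fun x => dilate m σ x * transformL2 d α (toL2 α φ) x)

/-- `F⁻¹` of the complex conjugate of `m_σ`. -/
def dualWavelet {d : ℕ} (α : ℝ) (m : Space d → ℂ) (σ : ℝ) : L2 d α :=
  (transformL2 d α).symm (toL2 α fun x => starRingEnd ℂ (dilate m σ x))

/-- Admissibility: `∫₀^∞ |m_σ(x)|² dσ/σ = 1` for almost every `x`. -/
def Admissible {d : ℕ} (α : ℝ) (m : Space d → ℂ) : Prop :=
  ∀ᵐ x ∂(mu d α), ∫ σ in Set.Ioi (0 : ℝ), ‖dilate m σ x‖ ^ 2 / σ = 1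

/-- The integrand, in `σ`, of the truncated reproducing formula. -/
def calderonIntegrand {d : ℕ} (α : ℝ) (m φ : Space d → ℂ) (x : Space d) (σ : ℝ) : ℂ :=
  conv α (multiplierOp α m σ φ) (dualWavelet α m σ) x / (σ : ℂ)

/-- `φ_{γ,δ}(x) = ∫_γ^δ (T_{w,m,σ} φ * F⁻¹(conj m_σ))(x) dσ/σ`. -/
def calderon {d : ℕ} (α : ℝ) (m φ : Space d → ℂ) (γ δ : ℝ) (x : Space d) : ℂ :=
  ∫ σ in γ..δ, calderonIntegrand α m φ x σ

end Weinstein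

end

/-! On the transform side the formula is a statement about multiplication operators. If the
Weinstein convolution is `∫ F f · F g · conj Λ(l, x) dμ(l)`, then `m_σ · conj m_σ = |m_σ|²` and
Fubini in `(σ, l)` give `φ_{γ,δ} = F⁻¹(K · F φ)` almost everywhere, where `K(l) = ∫_γ^δ |m(σ l)|²
dσ/σ`. Admissibility gives `0 ≤ K ≤ 1` and `K → 1` almost everywhere. Plancherel and dominated
convergence then give the limit in `L²` (`calderon_eq`, `calderon_ae_eq`, `eLpNorm_calderon_sub`,
`tendsto_eLpNorm_truncation`).

The harmonic analysis behind this is derived from the Gaussians `gauss a c t`, whose integrals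
against the kernel are explicit (`integral_gauss_mul_besselEntire`) and whose integrals determine
measures and functions on the half space (`ext_of_integral_gauss`,
`ae_eq_zero_of_integral_mul_gauss`). The transform sends Gaussians to Gaussians and preserves their
Gram matrix, which yields Plancherel (`exists_isometry_gaussL2`, `isPlancherelExtension_of_gaussL2`)
and inversion (`transformL2_symm_ae_eq`).

The generalized translation averages over an angle with a probability law. The map `translationMap
x` carries `μ ⊗` (law of the angle) to `μ` (`measurePreserving_translationMap`), again because the
Gaussian integrals agree. So the convolution of two `L²` functions is an absolutely convergent
integral at every `x`, continuous in each factor, and `conv_eq_integral_transformL2` need only be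
checked on Gaussians. -/

noncomputable section

namespace Weinstein

/-! ### The law of the angle: Beta integrals and cosine moments. -/

section Angle

variable {α : ℝ}

/-- The substitution `u = cos² θ` turns angular integrals over `(0, π/2)` into Beta integrals; the
other half of `(0, π)` is reached by `θ ↦ π - θ`. -/
theorem image_cos_sq_Ioo :
    (fun θ : ℝ => Real.cos θ ^ 2) '' Set.Ioo 0 (Real.pi / 2) = Set.Ioo 0 1 := by
  ext u
  constructor
  · rintro ⟨θ, ⟨h0, h1⟩, rfl⟩
    have hc : 0 < Real.cos θ := Real.cos_pos_of_mem_Ioo ⟨by linarith [Real.pi_pos], h1⟩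
    have hs : 0 < Real.sin θ := Real.sin_pos_of_pos_of_lt_pi h0 (by linarith [Real.pi_pos])
    have := Real.sin_sq_add_cos_sq θ
    exact ⟨by positivity, by nlinarith⟩
  · rintro ⟨h0, h1⟩
    have hs0 : 0 < √u := Real.sqrt_pos.2 h0
    have hs1 : √u < 1 := by rw [Real.sqrt_lt' one_pos]; simpa using h1
    refine ⟨Real.arccos √u, ⟨Real.arccos_pos.2 hs1, Real.arccos_lt_pi_div_two.2 hs0⟩, ?_⟩
    simp only
    rw [Real.cos_arccos (by linarith) hs1.le, Real.sq_sqrt h0.le]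

theorem injOn_cos_sq : Set.InjOn (fun θ : ℝ => Real.cos θ ^ 2) (Set.Ioo 0 (Real.pi / 2)) := by
  intro a ha b hb h
  have h1 : 0 < Real.cos a := Real.cos_pos_of_mem_Ioo ⟨by linarith [ha.1, Real.pi_pos], ha.2⟩
  have h2 : 0 < Real.cos b := Real.cos_pos_of_mem_Ioo ⟨by linarith [hb.1, Real.pi_pos], hb.2⟩
  have h3 : Real.cos a = Real.cos b := (pow_left_inj₀ h1.le h2.le two_ne_zero).1 h
  exact Real.injOn_cos ⟨ha.1.le, by linarith [ha.2, Real.pi_pos]⟩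
    ⟨hb.1.le, by linarith [hb.2, Real.pi_pos]⟩ h3

/-- The Jacobian `2 cos θ sin θ` supplies the powers missing from `cos^(2k-1) θ · sin^(2α-1) θ`. -/
theorem abs_deriv_smul_cos_sq (k : ℕ) {θ : ℝ} (hθ : θ ∈ Set.Ioo 0 (Real.pi / 2)) :
    |2 * Real.cos θ * -Real.sin θ| • ((Real.cos θ ^ 2) ^ ((k : ℝ) - 1 / 2) *
      (1 - Real.cos θ ^ 2) ^ (α - 1 / 2)) =
      2 * (Real.cos θ ^ (2 * k) * Real.sin θ ^ (2 * α)) := by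
  have hc : 0 < Real.cos θ := Real.cos_pos_of_mem_Ioo ⟨by linarith [hθ.1, Real.pi_pos], hθ.2⟩
  have hs : 0 < Real.sin θ :=
    Real.sin_pos_of_pos_of_lt_pi hθ.1 (by linarith [Real.pi_pos, hθ.2])
  have h1 : 1 - Real.cos θ ^ 2 = Real.sin θ ^ 2 := by linarith [Real.sin_sq_add_cos_sq θ]
  rw [h1, ← Real.rpow_natCast (Real.cos θ) 2, ← Real.rpow_natCast (Real.sin θ) 2,
    ← Real.rpow_mul hc.le, ← Real.rpow_mul hs.le, abs_of_nonpos (by nlinarith [mul_pos hc hs])]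
  have e1 : ((2 : ℕ) : ℝ) * ((k : ℝ) - 1 / 2) = ((2 * k : ℕ) : ℝ) - 1 := by push_cast; ring
  have e2 : ((2 : ℕ) : ℝ) * (α - 1 / 2) = 2 * α - 1 := by push_cast; ring
  rw [e1, e2, Real.rpow_sub_one hc.ne', Real.rpow_sub_one hs.ne', Real.rpow_natCast, smul_eq_mul]
  field_simp

theorem hasDerivWithinAt_cos_sq (θ : ℝ) (s : Set ℝ) :
    HasDerivWithinAt (fun θ : ℝ => Real.cos θ ^ 2) (2 * Real.cos θ * -Real.sin θ) s θ := by
  convert! ((Real.hasDerivAt_cos θ).pow 2).hasDerivWithinAt using 1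
  simp

theorem integrableOn_rpow_mul_one_sub_rpow {u v : ℝ} (hu : 0 < u) (hv : 0 < v) :
    IntegrableOn (fun x : ℝ => x ^ (u - 1) * (1 - x) ^ (v - 1)) (Set.Ioo 0 1) := by
  have h := (Complex.betaIntegral_convergent (u := u) (v := v) (by simpa) (by simpa)).norm
  rw [intervalIntegrable_iff_integrableOn_Ioo_of_le zero_le_one] at h
  refine h.congr_fun (fun x hx => ?_) measurableSet_Ioo
  have h1 : (1 : ℂ) - x = ((1 - x : ℝ) : ℂ) := by simp
  simp only [norm_mul]
  rw [h1, Complex.norm_cpow_eq_rpow_re_of_pos hx.1,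
    Complex.norm_cpow_eq_rpow_re_of_pos (by linarith [hx.2])]
  simp

theorem integral_rpow_mul_one_sub_rpow {u v : ℝ} (hu : 0 < u) (hv : 0 < v) :
    ∫ x in Set.Ioo (0 : ℝ) 1, x ^ (u - 1) * (1 - x) ^ (v - 1) =
      Real.Gamma u * Real.Gamma v / Real.Gamma (u + v) := by
  have h := Complex.betaIntegral_eq_Gamma_mul_div (u := u) (v := v) (by simpa) (by simpa)
  rw [Complex.betaIntegral, intervalIntegral.integral_of_le zero_le_one,
    integral_Ioc_eq_integral_Ioo, ← Complex.ofReal_add, Complex.Gamma_ofReal, Complex.Gamma_ofReal,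
    Complex.Gamma_ofReal] at h
  have h2 : ∫ x in Set.Ioo (0 : ℝ) 1, (x : ℂ) ^ ((u : ℂ) - 1) * (1 - (x : ℂ)) ^ ((v : ℂ) - 1) =
      ∫ x in Set.Ioo (0 : ℝ) 1, ((x ^ (u - 1) * (1 - x) ^ (v - 1) : ℝ) : ℂ) := by
    refine setIntegral_congr_fun measurableSet_Ioo fun x hx => ?_
    rw [Complex.ofReal_mul, Complex.ofReal_cpow hx.1.le,
      Complex.ofReal_cpow (by linarith [hx.2] : (0 : ℝ) ≤ 1 - x)]
    simp
  rw [h2, integral_complex_ofReal] at h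
  exact_mod_cast h

theorem intervalIntegrable_sin_rpow (hα : -(1 / 2 : ℝ) < α) :
    IntervalIntegrable (fun θ : ℝ => Real.sin θ ^ (2 * α)) volume 0 Real.pi := by
  have hpi := Real.pi_pos
  have h0 : IntervalIntegrable (fun θ : ℝ => Real.sin θ ^ (2 * α)) volume 0 (Real.pi / 2) := by
    rw [intervalIntegrable_iff_integrableOn_Ioo_of_le (by positivity)]
    have h := integrableOn_rpow_mul_one_sub_rpow (u := 1 / 2) (v := α + 1 / 2)
      (by norm_num) (by linarith)
    rw [← image_cos_sq_Ioo, integrableOn_image_iff_integrableOn_abs_deriv_smul measurableSet_Ioo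
      (fun θ _ => hasDerivWithinAt_cos_sq θ _) injOn_cos_sq] at h
    -- The case `k = 0` of the substitution produces `2 sin^(2α) θ`, hence the factor `1 / 2`.
    refine IntegrableOn.congr_fun (Integrable.const_mul h (1 / 2)) (fun θ hθ => ?_) measurableSet_Ioo
    have := abs_deriv_smul_cos_sq (α := α) 0 hθ
    rw [show (1 / 2 : ℝ) - 1 = ((0 : ℕ) : ℝ) - 1 / 2 by norm_num,
      show α + 1 / 2 - 1 = α - 1 / 2 by ring, this]
    simp
  refine h0.trans ?_
  have h1 := (h0.comp_sub_left Real.pi).symm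
  simp only [Real.sin_pi_sub, sub_zero] at h1
  rwa [show Real.pi - Real.pi / 2 = Real.pi / 2 by ring] at h1

theorem intervalIntegrable_cos_pow_mul_sin_rpow (hα : -(1 / 2 : ℝ) < α) (k : ℕ) :
    IntervalIntegrable (fun θ : ℝ => Real.cos θ ^ k * Real.sin θ ^ (2 * α)) volume 0 Real.pi :=
  (intervalIntegrable_sin_rpow hα).continuousOn_mul (by fun_prop)

theorem integral_cos_pow_mul_sin_rpow (hα : -(1 / 2 : ℝ) < α) (k : ℕ) :
    ∫ θ in (0 : ℝ)..Real.pi, Real.cos θ ^ (2 * k) * Real.sin θ ^ (2 * α) =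
      Real.Gamma (k + 1 / 2) * Real.Gamma (α + 1 / 2) / Real.Gamma (α + k + 1) := by
  have hpi := Real.pi_pos
  have hI := intervalIntegrable_cos_pow_mul_sin_rpow hα (2 * k)
  have hmem : Real.pi / 2 ∈ Set.uIcc 0 Real.pi := by
    rw [Set.uIcc_of_le hpi.le]; constructor <;> linarith
  rw [← intervalIntegral.integral_add_adjacent_intervals
    (hI.mono_set (Set.uIcc_subset_uIcc Set.left_mem_uIcc hmem))
    (hI.mono_set (Set.uIcc_subset_uIcc hmem Set.right_mem_uIcc))]
  have h1 : ∫ θ in (Real.pi / 2)..Real.pi, Real.cos θ ^ (2 * k) * Real.sin θ ^ (2 * α) =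
      ∫ θ in (0 : ℝ)..(Real.pi / 2), Real.cos θ ^ (2 * k) * Real.sin θ ^ (2 * α) := by
    have := intervalIntegral.integral_comp_sub_left (a := 0) (b := Real.pi / 2)
      (fun θ => Real.cos θ ^ (2 * k) * Real.sin θ ^ (2 * α)) Real.pi
    simp only [Real.cos_pi_sub, Real.sin_pi_sub, sub_zero, (even_two_mul k).neg_pow] at this
    rw [this, show Real.pi - Real.pi / 2 = Real.pi / 2 by ring]
  rw [h1, ← two_mul, ← intervalIntegral.integral_const_mul,
    intervalIntegral.integral_of_le (by positivity), integral_Ioc_eq_integral_Ioo]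
  have h2 := integral_rpow_mul_one_sub_rpow (u := k + 1 / 2) (v := α + 1 / 2)
    (by positivity) (by linarith)
  rw [← image_cos_sq_Ioo, integral_image_eq_integral_abs_deriv_smul measurableSet_Ioo
      (fun θ _ => hasDerivWithinAt_cos_sq θ _) injOn_cos_sq,
      show (k : ℝ) + 1 / 2 + (α + 1 / 2) = α + k + 1 by ring] at h2
  rw [← h2]
  refine setIntegral_congr_fun measurableSet_Ioo fun θ hθ => ?_
  rw [← abs_deriv_smul_cos_sq k hθ, show (k : ℝ) + 1 / 2 - 1 = k - 1 / 2 by ring,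
    show α + 1 / 2 - 1 = α - 1 / 2 by ring]

theorem gamma_nat_add_half (k : ℕ) :
    Real.Gamma (k + 1 / 2) = (2 * k).factorial * √Real.pi / (4 ^ k * k.factorial) := by
  induction k with
  | zero => simpa using Real.Gamma_one_half_eq
  | succ k ih =>
    have : ((k + 1 : ℕ) : ℝ) + 1 / 2 = (k + 1 / 2) + 1 := by push_cast; ring
    rw [this, Real.Gamma_add_one (by positivity), ih, show 2 * (k + 1) = 2 * k + 1 + 1 by ring,
      Nat.factorial_succ, Nat.factorial_succ, Nat.factorial_succ]
    push_cast
    field_simp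
    ring

/-- The normalizing constant of the generalized translation. -/
def angleConst (α : ℝ) : ℝ :=
  Real.Gamma (α + 1) / (√Real.pi * Real.Gamma (α + 1 / 2))

theorem angleConst_pos (hα : -(1 / 2 : ℝ) < α) : 0 < angleConst α := by
  have h1 := Real.Gamma_pos_of_pos (by linarith : 0 < α + 1)
  have h2 := Real.Gamma_pos_of_pos (by linarith : 0 < α + 1 / 2)
  unfold angleConst
  positivity

/-- The probability density of the angle in the generalized translation. -/
def angleDensity (α θ : ℝ) : ℝ := angleConst α * Real.sin θ ^ (2 * α)

/-- The law of the angle in the generalized translation. -/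
def angleMeasure (α : ℝ) : Measure ℝ :=
  (volume.restrict (Set.Ioc 0 Real.pi)).withDensity fun θ => ENNReal.ofReal (angleDensity α θ)

theorem measurable_angleDensity : Measurable (angleDensity α) := by
  unfold angleDensity; fun_prop

theorem angleDensity_nonneg (hα : -(1 / 2 : ℝ) < α) {θ : ℝ} (hθ : θ ∈ Set.Ioc 0 Real.pi) :
    0 ≤ angleDensity α θ :=
  mul_nonneg (angleConst_pos hα).le
    (Real.rpow_nonneg (Real.sin_nonneg_of_nonneg_of_le_pi hθ.1.le hθ.2) _)

theorem integral_angleMeasure (hα : -(1 / 2 : ℝ) < α) (f : ℝ → ℂ) :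
    ∫ θ, f θ ∂(angleMeasure α) =
      (angleConst α : ℂ) * ∫ θ in (0 : ℝ)..Real.pi, f θ * ((Real.sin θ ^ (2 * α) : ℝ) : ℂ) := by
  rw [angleMeasure, integral_withDensity_eq_integral_toReal_smul
    measurable_angleDensity.ennreal_ofReal (by simp), intervalIntegral.integral_of_le
      Real.pi_pos.le, ← integral_const_mul]
  refine setIntegral_congr_fun measurableSet_Ioc fun θ hθ => ?_
  rw [ENNReal.toReal_ofReal (angleDensity_nonneg hα hθ), angleDensity, Complex.real_smul]
  push_cast
  ring

theorem integrable_angleMeasure_iff (hα : -(1 / 2 : ℝ) < α) (f : ℝ → ℂ) :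
    Integrable f (angleMeasure α) ↔
      IntervalIntegrable (fun θ => f θ * ((Real.sin θ ^ (2 * α) : ℝ) : ℂ)) volume 0 Real.pi := by
  rw [angleMeasure, integrable_withDensity_iff_integrable_smul'
    measurable_angleDensity.ennreal_ofReal (by simp),
    intervalIntegrable_iff_integrableOn_Ioc_of_le Real.pi_pos.le, IntegrableOn]
  refine Iff.trans ?_ (integrable_const_mul_iff (c := (angleConst α : ℂ)) (by
      simpa using (angleConst_pos hα).ne') _)
  refine integrable_congr ((ae_restrict_iff' measurableSet_Ioc).2 (.of_forall fun θ hθ => ?_))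
  beta_reduce
  rw [ENNReal.toReal_ofReal (angleDensity_nonneg hα hθ), angleDensity, Complex.real_smul]
  push_cast
  ring

theorem integrable_one_angleMeasure (hα : -(1 / 2 : ℝ) < α) :
    Integrable (fun _ => (1 : ℂ)) (angleMeasure α) := by
  rw [integrable_angleMeasure_iff hα]
  simp only [one_mul]
  have h := intervalIntegrable_sin_rpow hα
  rw [intervalIntegrable_iff_integrableOn_Ioc_of_le Real.pi_pos.le] at h ⊢
  exact Integrable.ofReal h

theorem integral_cos_pow_angleMeasure (hα : -(1 / 2 : ℝ) < α) (k : ℕ) :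
    ∫ θ, ((Real.cos θ : ℝ) : ℂ) ^ (2 * k) ∂(angleMeasure α) =
      (Real.Gamma (α + 1) * (2 * k).factorial /
        (4 ^ k * k.factorial * Real.Gamma (α + k + 1)) : ℝ) := by
  rw [integral_angleMeasure hα]
  have h := integral_cos_pow_mul_sin_rpow hα k
  have h2 : ∫ θ in (0 : ℝ)..Real.pi, ((Real.cos θ : ℝ) : ℂ) ^ (2 * k) *
      ((Real.sin θ ^ (2 * α) : ℝ) : ℂ) =
      ((∫ θ in (0 : ℝ)..Real.pi, Real.cos θ ^ (2 * k) * Real.sin θ ^ (2 * α) : ℝ) : ℂ) := by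
    rw [← intervalIntegral.integral_ofReal]
    simp
  rw [h2, h, ← Complex.ofReal_mul, gamma_nat_add_half, angleConst]
  have h3 := (Real.Gamma_pos_of_pos (by linarith : 0 < α + 1 / 2)).ne'
  have h4 := (Real.Gamma_pos_of_pos (by linarith [k.cast_nonneg (α := ℝ)] : 0 < α + k + 1)).ne'
  have h5 : √Real.pi ≠ 0 := (Real.sqrt_pos.2 Real.pi_pos).ne'
  congr 1
  generalize Real.Gamma (α + 1 / 2) = g at *
  field_simp

theorem isProbabilityMeasure_angleMeasure (hα : -(1 / 2 : ℝ) < α) :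
    IsProbabilityMeasure (angleMeasure α) := by
  have : IsFiniteMeasure (angleMeasure α) :=
    (integrable_const_iff_isFiniteMeasure one_ne_zero).1 (integrable_one_angleMeasure hα)
  have h := integral_cos_pow_angleMeasure hα 0
  have h3 := (Real.Gamma_pos_of_pos (by linarith : 0 < α + 1)).ne'
  simp only [mul_zero, pow_zero, integral_const, Nat.factorial_zero, Nat.cast_one, Nat.cast_zero,
    add_zero, one_mul, mul_one, div_self h3] at h
  rw [Complex.real_smul, mul_one] at h
  have h4 : (angleMeasure α).real Set.univ = 1 := by exact_mod_cast h
  exact ⟨by rwa [measureReal_def, ENNReal.toReal_eq_one_iff] at h4⟩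

end Angle

/-! ### Poisson's integral representation of the Bessel function. -/

/-- The entire function `w ↦ Γ(α+1) ∑ₖ (w/4)ᵏ / (k! Γ(α+k+1))`, so that
`j_α(t) = besselEntire α (-t²)`. -/
def besselEntire (α : ℝ) (w : ℂ) : ℂ :=
  ∑' k : ℕ, (Real.Gamma (α + 1) : ℂ) * (w / 4) ^ k / (k.factorial * Real.Gamma (α + k + 1))

theorem besselj_eq_besselEntire (α t : ℝ) : (besselj α t : ℂ) = besselEntire α (-(t ^ 2 : ℝ)) := by
  rw [besselj, besselEntire, Complex.ofReal_mul, Complex.ofReal_tsum, ← tsum_mul_left]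
  refine tsum_congr fun k => ?_
  push_cast
  have h : (-1 : ℂ) ^ k * (t / 2) ^ (2 * k) = (-t ^ 2 / 4) ^ k := by
    rw [pow_mul, ← mul_pow]
    congr 1
    ring
  rw [h, mul_div_assoc]

section Entire

variable {α : ℝ}

/-- The reflection `θ ↦ π - θ` preserves the weight and changes the sign of the integrand, so the
integral equals its own negative. -/
theorem integral_sinh_mul_cos_angleMeasure (hα : -(1 / 2 : ℝ) < α) (z : ℂ) :
    ∫ θ, Complex.sinh (z * (Real.cos θ : ℝ)) ∂(angleMeasure α) = 0 := by
  rw [integral_angleMeasure hα]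
  have := intervalIntegral.integral_comp_sub_left (a := 0) (b := Real.pi)
      (fun θ => Complex.sinh (z * (Real.cos θ : ℝ)) * ((Real.sin θ ^ (2 * α) : ℝ) : ℂ)) Real.pi
  simp only [Real.cos_pi_sub, Real.sin_pi_sub, sub_zero, sub_self, Complex.ofReal_neg, mul_neg,
    Complex.sinh_neg, neg_mul, intervalIntegral.integral_neg] at this
  rw [self_eq_neg.1 this.symm, mul_zero]

theorem integrable_continuous_angleMeasure (hα : -(1 / 2 : ℝ) < α) {f : ℝ → ℂ}
    (hf : Continuous f) {C : ℝ} (hC : ∀ θ, ‖f θ‖ ≤ C) : Integrable f (angleMeasure α) :=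
  have := isProbabilityMeasure_angleMeasure hα
  Integrable.of_bound hf.aestronglyMeasurable C (.of_forall hC)

/-- Termwise integration of the cosh series, dominated by the series of `cosh ‖z‖`. The `(2k)!` in
the cosine moment cancels the one in the cosh coefficient and leaves the Bessel coefficient. -/
theorem hasSum_besselEntire (hα : -(1 / 2 : ℝ) < α) (z : ℂ) :
    HasSum (fun k : ℕ => (Real.Gamma (α + 1) : ℂ) * (z ^ 2 / 4) ^ k /
      (k.factorial * Real.Gamma (α + k + 1)))
      (∫ θ, Complex.cosh (z * (Real.cos θ : ℝ)) ∂(angleMeasure α)) := by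
  have := isProbabilityMeasure_angleMeasure hα
  have hb : ∀ (k : ℕ) (θ : ℝ), ‖(z * (Real.cos θ : ℝ)) ^ (2 * k) / ((2 * k).factorial : ℂ)‖ ≤
      ‖z‖ ^ (2 * k) / (2 * k).factorial := by
    intro k θ
    rw [norm_div, norm_pow, norm_mul, Complex.norm_natCast, Complex.norm_real]
    gcongr
    exact mul_le_of_le_one_right (norm_nonneg _) (Real.abs_cos_le_one θ)
  have hi : ∀ k : ℕ, Integrable
      (fun θ : ℝ => (z * (Real.cos θ : ℝ)) ^ (2 * k) / ((2 * k).factorial : ℂ))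
      (angleMeasure α) := fun k =>
    integrable_continuous_angleMeasure hα (by fun_prop) (hb k)
  have h := hasSum_integral_of_summable_integral_norm hi (by
    refine Summable.of_nonneg_of_le (fun k => integral_nonneg fun _ => norm_nonneg _)
      (fun k => ?_) (Real.hasSum_cosh ‖z‖).summable
    refine (integral_mono (hi k).norm (integrable_const _) (hb k)).trans ?_
    simp)
  simp_rw [(Complex.hasSum_cosh _).tsum_eq] at h
  convert! h using 1
  ext k
  simp_rw [mul_pow]
  rw [integral_div, integral_const_mul, integral_cos_pow_angleMeasure hα]
  push_cast
  have h4 : (Real.Gamma (α + k + 1) : ℂ) ≠ 0 := by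
    exact_mod_cast
      (Real.Gamma_pos_of_pos (by linarith [k.cast_nonneg (α := ℝ)] : 0 < α + k + 1)).ne'
  have h5 : ((2 * k).factorial : ℂ) ≠ 0 := by exact_mod_cast (2 * k).factorial_ne_zero
  have h6 : (k.factorial : ℂ) ≠ 0 := by exact_mod_cast k.factorial_ne_zero
  rw [div_pow, ← pow_mul]
  field_simp

/-- The cosh part is the Bessel series and the sinh part vanishes by symmetry. Imaginary `z` gives
`j_α`; real `z` gives the angular average of a translated Gaussian. -/
theorem integral_exp_mul_cos_angleMeasure (hα : -(1 / 2 : ℝ) < α) (z : ℂ) :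
    ∫ θ, Complex.exp (z * (Real.cos θ : ℝ)) ∂(angleMeasure α) = besselEntire α (z ^ 2) := by
  have hb : ∀ θ : ℝ, ‖z * (Real.cos θ : ℝ)‖ ≤ ‖z‖ := by
    intro θ
    rw [norm_mul, Complex.norm_real]
    exact mul_le_of_le_one_right (norm_nonneg _) (Real.abs_cos_le_one θ)
  have he : ∀ θ : ℝ, ‖Complex.exp (z * (Real.cos θ : ℝ))‖ ≤ Real.exp ‖z‖ := fun θ =>
    (Complex.norm_exp_le_exp_norm _).trans (Real.exp_le_exp.2 (hb θ))
  have he' : ∀ θ : ℝ, ‖Complex.exp (-(z * (Real.cos θ : ℝ)))‖ ≤ Real.exp ‖z‖ := fun θ =>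
    (Complex.norm_exp_le_exp_norm _).trans (Real.exp_le_exp.2 (by rw [norm_neg]; exact hb θ))
  have i1 := integrable_continuous_angleMeasure hα (by fun_prop) he
  have i2 := integrable_continuous_angleMeasure hα (by fun_prop) he'
  have ic : Integrable (fun θ => Complex.cosh (z * (Real.cos θ : ℝ))) (angleMeasure α) :=
    (i1.add i2).div_const 2
  have is : Integrable (fun θ => Complex.sinh (z * (Real.cos θ : ℝ))) (angleMeasure α) :=
    (i1.sub i2).div_const 2
  simp_rw [← Complex.cosh_add_sinh]
  rw [integral_add ic is, integral_sinh_mul_cos_angleMeasure hα, add_zero, besselEntire,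
    (hasSum_besselEntire hα z).tsum_eq]

theorem besselj_eq_integral (hα : -(1 / 2 : ℝ) < α) (t : ℝ) :
    (besselj α t : ℂ) =
      ∫ θ, Complex.exp (((t * Real.cos θ : ℝ) : ℂ) * Complex.I) ∂(angleMeasure α) := by
  rw [besselj_eq_besselEntire, show (-(t ^ 2 : ℝ) : ℂ) = (t * Complex.I) ^ 2 by
    rw [mul_pow, Complex.I_sq]; push_cast; ring, ← integral_exp_mul_cos_angleMeasure hα]
  refine integral_congr_ae (.of_forall fun θ => congrArg Complex.exp ?_)
  push_cast
  ring

theorem abs_besselj_le_one (hα : -(1 / 2 : ℝ) < α) (t : ℝ) : |besselj α t| ≤ 1 := by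
  have := isProbabilityMeasure_angleMeasure hα
  rw [← Real.norm_eq_abs, ← Complex.norm_real, besselj_eq_integral hα]
  refine (norm_integral_le_of_norm_le_const (C := 1) (.of_forall fun θ => ?_)).trans (by simp)
  rw [Complex.norm_exp_ofReal_mul_I]

theorem continuous_besselj (hα : -(1 / 2 : ℝ) < α) : Continuous (besselj α) := by
  have := isProbabilityMeasure_angleMeasure hα
  have h : Continuous fun t => (besselj α t : ℂ) := by
    simp_rw [besselj_eq_integral hα]
    refine continuous_of_dominated (bound := fun _ => 1) (fun t => by fun_prop)
      (fun t => .of_forall fun θ => ?_) (integrable_const _) (.of_forall fun θ => by fun_prop)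
    rw [Complex.norm_exp_ofReal_mul_I]
  exact Complex.continuous_re.comp h

end Entire

/-! ### Radial Gaussian integrals of the Bessel function. -/

section Radial

variable {α : ℝ}

theorem integral_rpow_mul_gaussian (hα : -1 < α) {t : ℝ} (ht : 0 < t) (k : ℕ) :
    ∫ y in Set.Ioi (0 : ℝ), y ^ (2 * α + 1) * Real.exp (-t / 2 * y ^ 2) * (y ^ 2) ^ k =
      (t / 2) ^ (-(α + k + 1)) / 2 * Real.Gamma (α + k + 1) := by
  have h := integral_rpow_mul_exp_neg_mul_rpow (p := 2) (q := 2 * α + 1 + 2 * k) (b := t / 2)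
    (by norm_num) (by linarith [k.cast_nonneg (α := ℝ)]) (by positivity)
  rw [show (2 * α + 1 + 2 * k + 1) / 2 = α + k + 1 by ring,
    show -(2 * α + 1 + 2 * k + 1) / 2 = -(α + k + 1) by ring] at h
  rw [div_eq_mul_one_div ((t / 2) ^ (-(α + k + 1))), ← h]
  refine setIntegral_congr_fun measurableSet_Ioi fun y hy => ?_
  have hy : 0 < y := hy
  rw [Real.rpow_add hy (2 * α + 1), show ((2 : ℝ) * k) = ((2 * k : ℕ) : ℝ) by push_cast; ring,
    Real.rpow_natCast, Real.rpow_two, pow_mul, neg_div]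
  ring

theorem integrableOn_rpow_mul_gaussian (hα : -1 < α) {t : ℝ} (ht : 0 < t) (k : ℕ) :
    IntegrableOn (fun y : ℝ => y ^ (2 * α + 1) * Real.exp (-t / 2 * y ^ 2) * (y ^ 2) ^ k)
      (Set.Ioi 0) := by
  have h := integrableOn_rpow_mul_exp_neg_mul_sq (b := t / 2) (by positivity)
    (s := 2 * α + 1 + 2 * k) (by linarith [k.cast_nonneg (α := ℝ)])
  refine h.congr_fun (fun y hy => ?_) measurableSet_Ioi
  have hy : 0 < y := hy
  beta_reduce
  rw [Real.rpow_add hy (2 * α + 1), show ((2 : ℝ) * k) = ((2 * k : ℕ) : ℝ) by push_cast; ring,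
    Real.rpow_natCast, pow_mul, neg_div]
  ring

/-- The `k`-th Gaussian moment contains `Γ(α+k+1)`, which cancels the one in the Bessel coefficient,
so the termwise integrals form an exponential series. -/
theorem integral_rpow_mul_gaussian_mul_besselEntire (hα : -(1 / 2 : ℝ) < α) {t : ℝ} (ht : 0 < t)
    (w : ℂ) :
    ∫ y in Set.Ioi (0 : ℝ), ((y ^ (2 * α + 1) * Real.exp (-t / 2 * y ^ 2) : ℝ) : ℂ) *
      besselEntire α (w * (y : ℂ) ^ 2) =
      ((2 ^ α * Real.Gamma (α + 1) * t ^ (-(α + 1)) : ℝ) : ℂ) * Complex.exp (w / (2 * t)) := by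
  have hα' : -1 < α := by linarith
  have hG : 0 < Real.Gamma (α + 1) := Real.Gamma_pos_of_pos (by linarith)
  have hGk : ∀ k : ℕ, 0 < Real.Gamma (α + k + 1) := fun k =>
    Real.Gamma_pos_of_pos (by linarith [k.cast_nonneg (α := ℝ)])
  let F : ℕ → ℝ → ℂ := fun k y =>
    ((Real.Gamma (α + 1) : ℂ) * (w / 4) ^ k / (k.factorial * Real.Gamma (α + k + 1))) *
      ((y ^ (2 * α + 1) * Real.exp (-t / 2 * y ^ 2) * (y ^ 2) ^ k : ℝ) : ℂ)
  have hF : ∀ y : ℝ, ((y ^ (2 * α + 1) * Real.exp (-t / 2 * y ^ 2) : ℝ) : ℂ) *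
      besselEntire α (w * (y : ℂ) ^ 2) = ∑' k, F k y := by
    intro y
    rw [besselEntire, ← tsum_mul_left]
    refine tsum_congr fun k => ?_
    simp only [F, mul_div_right_comm w, mul_pow]
    push_cast
    ring
  have hpow : ∀ k : ℕ, (t / 2) ^ (-(α + k + 1)) / 2 =
      2 ^ α * t ^ (-(α + 1)) * (2 / t) ^ k := by
    intro k
    rw [show -(α + k + 1) = -(α + 1) - k by ring, Real.rpow_sub_natCast (by positivity),
      Real.div_rpow ht.le (by norm_num), Real.rpow_neg (by norm_num : (0 : ℝ) ≤ 2),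
      Real.rpow_add_one (by norm_num), div_pow, div_pow]
    field_simp
  have hint : ∀ k, Integrable (F k) (volume.restrict (Set.Ioi 0)) := fun k =>
    (Integrable.ofReal (integrableOn_rpow_mul_gaussian hα' ht k)).const_mul _
  have hval : ∀ k, ∫ y in Set.Ioi (0 : ℝ), F k y =
      ((2 ^ α * Real.Gamma (α + 1) * t ^ (-(α + 1)) : ℝ) : ℂ) *
        ((w / (2 * t)) ^ k / k.factorial) := by
    intro k
    simp only [F]
    rw [integral_const_mul, integral_complex_ofReal, integral_rpow_mul_gaussian hα' ht, hpow]
    have h1 : (Real.Gamma (α + k + 1) : ℂ) ≠ 0 := by exact_mod_cast (hGk k).ne'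
    have h2 : (w / (2 * t)) ^ k = (w / 4) ^ k * (2 / t) ^ k := by
      rw [← mul_pow]
      congr 1
      have : (t : ℂ) ≠ 0 := by exact_mod_cast ht.ne'
      field_simp
      norm_num
    rw [h2]
    push_cast
    have h6 : (k.factorial : ℂ) ≠ 0 := by exact_mod_cast k.factorial_ne_zero
    field_simp
  -- The same computation with `‖w‖` in place of `w` gives the absolute summability that justifies
  -- termwise integration.
  have hnorm : ∀ k, ∫ y in Set.Ioi (0 : ℝ), ‖F k y‖ =
      (2 ^ α * Real.Gamma (α + 1) * t ^ (-(α + 1))) *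
        ((‖w‖ / (2 * t)) ^ k / k.factorial) := by
    intro k
    have h0 : ∫ y in Set.Ioi (0 : ℝ), ‖F k y‖ = ∫ y in Set.Ioi (0 : ℝ),
      ((Real.Gamma (α + 1)) * (‖w‖ / 4) ^ k / (k.factorial * Real.Gamma (α + k + 1))) *
      (y ^ (2 * α + 1) * Real.exp (-t / 2 * y ^ 2) * (y ^ 2) ^ k) := by
      refine setIntegral_congr_fun measurableSet_Ioi fun y hy => ?_
      have hy : 0 < y := hy
      simp only [F, norm_mul, norm_div, norm_pow, Complex.norm_real, Real.norm_eq_abs,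
        Complex.norm_natCast, abs_of_pos hG, abs_of_pos (hGk k), Real.abs_exp,
        abs_of_pos hy, abs_of_pos (Real.rpow_pos_of_pos hy _), Complex.norm_ofNat]
    rw [h0, integral_const_mul, integral_rpow_mul_gaussian hα' ht, hpow]
    have h2 : (‖w‖ / (2 * t)) ^ k = (‖w‖ / 4) ^ k * (2 / t) ^ k := by
      rw [← mul_pow]
      congr 1
      field_simp
      norm_num
    rw [h2]
    have h1 := (hGk k).ne'
    field_simp
  have hs := hasSum_integral_of_summable_integral_norm hint (by
    simp_rw [hnorm]
    exact (Real.summable_pow_div_factorial _).mul_left _)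
  simp_rw [hval] at hs
  have hs2 := (NormedSpace.expSeries_div_hasSum_exp (w / (2 * t))).mul_left
    ((2 ^ α * Real.Gamma (α + 1) * t ^ (-(α + 1)) : ℝ) : ℂ)
  rw [← Complex.exp_eq_exp_ℂ] at hs2
  simp_rw [hF]
  exact hs.unique hs2

end Radial

/-! ### The measure, Gaussians and their integrals against the kernel. -/

section Mu

variable {d : ℕ} {α : ℝ}

/-- The density of `mu` as a function of the last coordinate. -/
def muDensity (d : ℕ) (α y : ℝ) : ℝ :=
  y ^ (2 * α + 1) / ((2 * Real.pi) ^ ((d : ℝ) / 2) * (2 : ℝ) ^ α * Real.Gamma (α + 1))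

theorem measurable_muDensity : Measurable (muDensity d α) := by
  unfold muDensity; fun_prop

theorem muDensity_pos (hα : -(1 / 2 : ℝ) < α) {y : ℝ} (hy : 0 < y) : 0 < muDensity d α y := by
  have := Real.Gamma_pos_of_pos (by linarith : 0 < α + 1)
  unfold muDensity
  positivity

theorem restrict_halfSpace :
    (volume : Measure (Space d)).restrict {x | 0 < x.2} =
      (volume : Measure (EuclideanSpace ℝ (Fin d))).prod (volume.restrict (Set.Ioi (0 : ℝ))) := by
  rw [Measure.volume_eq_prod]
  nth_rewrite 2 [← Measure.restrict_univ (μ := (volume : Measure (EuclideanSpace ℝ (Fin d))))]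
  rw [Measure.prod_restrict]
  congr 1
  ext x
  simp

theorem mu_eq_withDensity :
    mu d α = ((volume : Measure (EuclideanSpace ℝ (Fin d))).prod
      (volume.restrict (Set.Ioi (0 : ℝ)))).withDensity
        fun x => ENNReal.ofReal (muDensity d α x.2) := by
  rw [← restrict_halfSpace]; rfl

theorem measurable_density :
    Measurable fun x : Space d => ENNReal.ofReal (muDensity d α x.2) :=
  (measurable_muDensity.comp measurable_snd).ennreal_ofReal

theorem ae_pos_prod :
    ∀ᵐ x ∂((volume : Measure (EuclideanSpace ℝ (Fin d))).prod
      (volume.restrict (Set.Ioi (0 : ℝ)))), 0 < x.2 := by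
  rw [← restrict_halfSpace]
  exact ae_restrict_mem (measurableSet_lt measurable_const measurable_snd)

theorem ae_mu_pos : ∀ᵐ x ∂(mu d α), 0 < x.2 := by
  rw [mu_eq_withDensity]
  exact (withDensity_absolutelyContinuous _ _).ae_le ae_pos_prod

theorem integral_mu (hα : -(1 / 2 : ℝ) < α) (f : Space d → ℂ) :
    ∫ x, f x ∂(mu d α) = ∫ x, (muDensity d α x.2 : ℂ) * f x
      ∂((volume : Measure (EuclideanSpace ℝ (Fin d))).prod
        (volume.restrict (Set.Ioi (0 : ℝ)))) := by
  rw [mu_eq_withDensity, integral_withDensity_eq_integral_toReal_smul measurable_density (by simp)]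
  refine integral_congr_ae (ae_pos_prod.mono fun x hx => ?_)
  beta_reduce
  rw [ENNReal.toReal_ofReal (muDensity_pos hα hx).le, Complex.real_smul]

theorem integrable_mu_iff (hα : -(1 / 2 : ℝ) < α) (f : Space d → ℂ) :
    Integrable f (mu d α) ↔ Integrable (fun x => (muDensity d α x.2 : ℂ) * f x)
      ((volume : Measure (EuclideanSpace ℝ (Fin d))).prod
        (volume.restrict (Set.Ioi (0 : ℝ)))) := by
  rw [mu_eq_withDensity,
    integrable_withDensity_iff_integrable_smul' measurable_density (by simp)]
  refine integrable_congr (ae_pos_prod.mono fun x hx => ?_)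
  beta_reduce
  rw [ENNReal.toReal_ofReal (muDensity_pos hα hx).le, Complex.real_smul]

instance : SFinite (mu d α) := by
  rw [mu_eq_withDensity]; infer_instance

/-- The functions `exp(-a|x'|²/2 + c·x' - t x_{d+1}²/2)`. -/
def gauss (a : ℝ) (c : Fin d → ℂ) (t : ℝ) (x : Space d) : ℂ :=
  Complex.exp (-(a : ℂ) / 2 * ∑ i, (x.1 i : ℂ) ^ 2 + ∑ i, c i * x.1 i) *
    (Real.exp (-t / 2 * x.2 ^ 2) : ℝ)

theorem continuous_gauss (a : ℝ) (c : Fin d → ℂ) (t : ℝ) : Continuous (gauss a c t) := by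
  unfold gauss; fun_prop

theorem gauss_mul_gauss (a a' : ℝ) (c c' : Fin d → ℂ) (t t' : ℝ) (x : Space d) :
    gauss a c t x * gauss a' c' t' x = gauss (a + a') (c + c') (t + t') x := by
  unfold gauss
  rw [mul_mul_mul_comm, ← Complex.exp_add, ← Complex.ofReal_mul, ← Real.exp_add]
  simp only [Pi.add_apply, add_mul, Finset.sum_add_distrib]
  congr 2
  · push_cast; ring
  · congr 1; ring

theorem conj_gauss (a : ℝ) (c : Fin d → ℂ) (t : ℝ) (x : Space d) :
    starRingEnd ℂ (gauss a c t x) = gauss a (star c) t x := by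
  unfold gauss
  rw [map_mul, ← Complex.exp_conj, Complex.conj_ofReal]
  simp [Complex.conj_ofNat]

theorem norm_gauss (a : ℝ) (c : Fin d → ℂ) (t : ℝ) (x : Space d) :
    (‖gauss a c t x‖ : ℂ) = gauss a (fun i => ((c i).re : ℂ)) t x := by
  unfold gauss
  rw [norm_mul, Complex.norm_exp, Complex.norm_real, Real.norm_eq_abs, Real.abs_exp,
    Complex.ofReal_mul]
  congr 1
  rw [Complex.ofReal_exp]
  congr 1
  have h : -(a : ℂ) / 2 * ∑ i, (x.1 i : ℂ) ^ 2 = ((-a / 2 * ∑ i, (x.1 i) ^ 2 : ℝ) : ℂ) := by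
    push_cast; ring
  rw [h, Complex.add_re, Complex.ofReal_re, Complex.re_sum]
  simp

theorem integral_euclidean_gauss {a : ℝ} (ha : 0 < a) (c : Fin d → ℂ) :
    ∫ v : EuclideanSpace ℝ (Fin d),
      Complex.exp (-(a : ℂ) / 2 * ∑ i, (v i : ℂ) ^ 2 + ∑ i, c i * v i) =
      (((2 * Real.pi) ^ ((d : ℝ) / 2) * a ^ (-((d : ℝ) / 2)) : ℝ) : ℂ) *
        Complex.exp ((∑ i, c i ^ 2) / (2 * a)) := by
  rw [← (PiLp.volume_preserving_toLp (Fin d)).integral_comp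
    (MeasurableEquiv.toLp 2 _).measurableEmbedding]
  have h := GaussianFourier.integral_cexp_neg_mul_sum_add (b := (a : ℂ) / 2)
    (by simpa using ha) c
  simp only [neg_div]
  rw [h, Fintype.card_fin]
  congr 1
  · rw [Real.rpow_neg ha.le, ← div_eq_mul_inv, ← Real.div_rpow (by positivity) ha.le,
      Complex.ofReal_cpow (by positivity)]
    push_cast
    congr 1
    ring
  · congr 1
    ring

theorem integrable_euclidean_gauss {a : ℝ} (ha : 0 < a) (c : Fin d → ℂ) :
    Integrable fun v : EuclideanSpace ℝ (Fin d) =>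
      Complex.exp (-(a : ℂ) / 2 * ∑ i, (v i : ℂ) ^ 2 + ∑ i, c i * v i) := by
  rw [← (PiLp.volume_preserving_toLp (Fin d)).integrable_comp_emb
    (MeasurableEquiv.toLp 2 _).measurableEmbedding]
  have h := GaussianFourier.integrable_cexp_neg_mul_sum_add (b := (a : ℂ) / 2)
    (by simpa using ha) c
  simp only [neg_div]
  exact h

theorem integrable_gauss (hα : -(1 / 2 : ℝ) < α) {a t : ℝ} (ha : 0 < a) (ht : 0 < t)
    (c : Fin d → ℂ) : Integrable (gauss a c t) (mu d α) := by
  rw [integrable_mu_iff hα]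
  have h1 := integrableOn_rpow_mul_gaussian (by linarith : -1 < α) ht 0
  have h1' : Integrable (fun y : ℝ => ((y ^ (2 * α + 1) * Real.exp (-t / 2 * y ^ 2) *
      (y ^ 2) ^ 0 : ℝ) : ℂ)) (volume.restrict (Set.Ioi 0)) := Integrable.ofReal h1
  have h2 := (integrable_euclidean_gauss ha c).mul_prod (h1'.const_mul
      (((2 * Real.pi) ^ ((d : ℝ) / 2) * (2 : ℝ) ^ α * Real.Gamma (α + 1) : ℝ) : ℂ)⁻¹)
  refine h2.congr (.of_forall fun x => ?_)
  simp only [gauss, muDensity, Complex.ofReal_mul, Complex.ofReal_div, pow_zero, mul_one]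
  ring

/-- The constants of the Euclidean and radial integrals cancel the normalization of `mu`. The
parameter `w` covers three uses: `w = 0` for plain integrals, `w = -l_{d+1}²` for the kernel, and `w
= s²` for the translation. -/
theorem integral_gauss_mul_besselEntire (hα : -(1 / 2 : ℝ) < α) {a t : ℝ} (ha : 0 < a)
    (ht : 0 < t) (c : Fin d → ℂ) (w : ℂ) :
    ∫ x, gauss a c t x * besselEntire α (w * (x.2 : ℂ) ^ 2) ∂(mu d α) =
      ((a ^ (-((d : ℝ) / 2)) * t ^ (-(α + 1)) : ℝ) : ℂ) *
        Complex.exp ((∑ i, c i ^ 2) / (2 * a) + w / (2 * t)) := by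
  rw [integral_mu hα]
  have h0 : ∀ x : Space d, (muDensity d α x.2 : ℂ) *
      (gauss a c t x * besselEntire α (w * (x.2 : ℂ) ^ 2)) =
      (((2 * Real.pi) ^ ((d : ℝ) / 2) * (2 : ℝ) ^ α * Real.Gamma (α + 1) : ℝ) : ℂ)⁻¹ *
      (Complex.exp (-(a : ℂ) / 2 * ∑ i, (x.1 i : ℂ) ^ 2 + ∑ i, c i * x.1 i) *
        (((x.2 ^ (2 * α + 1) * Real.exp (-t / 2 * x.2 ^ 2) : ℝ) : ℂ) *
          besselEntire α (w * (x.2 : ℂ) ^ 2))) := by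
    intro x
    simp only [gauss, muDensity]
    push_cast
    ring
  simp_rw [h0]
  rw [integral_const_mul, integral_prod_mul
    (fun v : EuclideanSpace ℝ (Fin d) =>
      Complex.exp (-(a : ℂ) / 2 * ∑ i, (v i : ℂ) ^ 2 + ∑ i, c i * v i))
    (fun y : ℝ => (((y ^ (2 * α + 1) * Real.exp (-t / 2 * y ^ 2) : ℝ) : ℂ) *
          besselEntire α (w * (y : ℂ) ^ 2))),
    integral_euclidean_gauss ha, integral_rpow_mul_gaussian_mul_besselEntire hα ht, Complex.exp_add]
  have h1 : (((2 * Real.pi) ^ ((d : ℝ) / 2) : ℝ) : ℂ) ≠ 0 := by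
    exact_mod_cast (by positivity : (2 * Real.pi) ^ ((d : ℝ) / 2) ≠ 0)
  have h2 : (((2 : ℝ) ^ α : ℝ) : ℂ) ≠ 0 := by
    exact_mod_cast (by positivity : (2 : ℝ) ^ α ≠ 0)
  have h3 : (Real.Gamma (α + 1) : ℂ) ≠ 0 := by
    exact_mod_cast (Real.Gamma_pos_of_pos (by linarith : 0 < α + 1)).ne'
  rw [Complex.ofReal_mul, Complex.ofReal_mul, Complex.ofReal_mul, Complex.ofReal_mul,
    Complex.ofReal_mul, Complex.ofReal_mul]
  field_simp

theorem besselEntire_zero (hα : -(1 / 2 : ℝ) < α) : besselEntire α 0 = 1 := by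
  have := isProbabilityMeasure_angleMeasure hα
  have h := integral_exp_mul_cos_angleMeasure hα 0
  simpa using h.symm

theorem integral_gauss (hα : -(1 / 2 : ℝ) < α) {a t : ℝ} (ha : 0 < a)
    (ht : 0 < t) (c : Fin d → ℂ) :
    ∫ x, gauss a c t x ∂(mu d α) =
      ((a ^ (-((d : ℝ) / 2)) * t ^ (-(α + 1)) : ℝ) : ℂ) *
        Complex.exp ((∑ i, c i ^ 2) / (2 * a)) := by
  have h := integral_gauss_mul_besselEntire hα ha ht c 0
  simpa only [zero_mul, besselEntire_zero hα, mul_one, zero_div, add_zero] using h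

/-- The squared modulus of a Gaussian is an integrable Gaussian with `a` and `t` doubled and linear
term `star c + c`. -/
theorem memLp_gauss (hα : -(1 / 2 : ℝ) < α) {a t : ℝ} (ha : 0 < a) (ht : 0 < t)
    (c : Fin d → ℂ) : MemLp (gauss a c t) 2 (mu d α) := by
  rw [memLp_two_iff_integrable_sq_norm (continuous_gauss a c t).aestronglyMeasurable]
  have h := (integrable_gauss hα (add_pos ha ha) (add_pos ht ht) (star c + c) (d := d)).norm
  refine h.congr (.of_forall fun x => ?_)
  beta_reduce
  rw [← gauss_mul_gauss, ← conj_gauss, norm_mul, RCLike.norm_conj, sq]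

/-! ### The kernel -/

theorem norm_kernel_le_one (hα : -(1 / 2 : ℝ) < α) (l x : Space d) : ‖kernel α l x‖ ≤ 1 := by
  rw [kernel, norm_mul, Complex.norm_exp, Complex.norm_real]
  simpa using abs_besselj_le_one hα (x.2 * l.2)

theorem continuous_kernel (hα : -(1 / 2 : ℝ) < α) :
    Continuous fun p : Space d × Space d => kernel α p.1 p.2 := by
  have := continuous_besselj hα
  unfold kernel
  fun_prop

theorem kernel_comm (l x : Space d) : kernel α l x = kernel α x l := by
  rw [kernel, kernel, real_inner_comm, mul_comm x.2]

/-- The plane wave of the kernel is absorbed by an imaginary shift of `c`; this is one reason for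
letting `c` be complex. -/
theorem gauss_mul_kernel (a : ℝ) (c : Fin d → ℂ) (t : ℝ) (l x : Space d) :
    gauss a c t x * kernel α l x =
      gauss a (fun i => c i - Complex.I * l.1 i) t x *
        besselEntire α (-(l.2 : ℂ) ^ 2 * (x.2 : ℂ) ^ 2) := by
  rw [kernel, besselj_eq_besselEntire, gauss, gauss, PiLp.inner_apply]
  have h : ∀ e₁ r e₂ b : ℂ, e₁ * r * (e₂ * b) = (e₁ * e₂) * r * b := by intros; ring
  rw [h, ← Complex.exp_add]
  congr 3
  · have hs : ∑ i, (c i - Complex.I * l.1 i) * (x.1 i : ℂ) =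
        ∑ i, c i * (x.1 i : ℂ) - Complex.I * ∑ i, (l.1 i : ℂ) * x.1 i := by
      rw [Finset.mul_sum, ← Finset.sum_sub_distrib]
      exact Finset.sum_congr rfl fun i _ => by ring
    rw [hs]
    simp only [RCLike.inner_apply, conj_trivial]
    push_cast
    ring
  · push_cast; ring

theorem gauss_mul_conj_kernel (a : ℝ) (c : Fin d → ℂ) (t : ℝ) (l x : Space d) :
    gauss a c t x * starRingEnd ℂ (kernel α l x) =
      gauss a (fun i => c i + Complex.I * l.1 i) t x *
        besselEntire α (-(l.2 : ℂ) ^ 2 * (x.2 : ℂ) ^ 2) := by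
  have h : starRingEnd ℂ (kernel α l x) = kernel α (-l.1, l.2) x := by
    rw [kernel, kernel, map_mul, ← Complex.exp_conj, Complex.conj_ofReal]
    simp
  rw [h, gauss_mul_kernel]
  simp

end Mu

/-! ### Gaussians determine measures and functions on the half space. -/

section Totality

open scoped BoundedContinuousFunction NNReal

variable {d : ℕ} {α : ℝ}

/-- The purely imaginary frequency `i b`. -/
def freq (b : Fin d → ℝ) : Fin d → ℂ := fun i => Complex.I * b i

theorem freq_add (b b' : Fin d → ℝ) : freq b + freq b' = freq (b + b') := by
  ext i; simp [freq, mul_add]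

theorem star_freq (b : Fin d → ℝ) : star (freq b) = freq (-b) := by
  ext i; simp [freq]

theorem freq_zero : freq (0 : Fin d → ℝ) = 0 := by
  ext i; simp [freq]

theorem norm_gauss_freq (a : ℝ) (b : Fin d → ℝ) (t : ℝ) (x : Space d) :
    ‖gauss a (freq b) t x‖ = Real.exp (-a / 2 * ∑ i, (x.1 i) ^ 2) * Real.exp (-t / 2 * x.2 ^ 2) := by
  have h := norm_gauss a (freq b) t x
  have h2 : gauss a (fun i => ((freq b i).re : ℂ)) t x =
      ((Real.exp (-a / 2 * ∑ i, (x.1 i) ^ 2) * Real.exp (-t / 2 * x.2 ^ 2) : ℝ) : ℂ) := by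
    simp only [gauss, freq, Complex.mul_re, Complex.I_re, Complex.ofReal_re, zero_mul,
      Complex.I_im, Complex.ofReal_im, mul_zero, sub_zero, Complex.ofReal_zero,
      Finset.sum_const_zero, add_zero]
    push_cast
    rfl
  exact_mod_cast h.trans h2

/-- `gauss 0 (i b) n` as a bounded continuous function on `ℝᵈ × [0, ∞)`. -/
def charGauss (p : (Fin d → ℝ) × ℕ) : (EuclideanSpace ℝ (Fin d) × ℝ≥0) →ᵇ ℂ :=
  BoundedContinuousFunction.ofNormedAddCommGroup
    (fun x => gauss 0 (freq p.1) p.2 (x.1, (x.2 : ℝ)))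
    ((continuous_gauss _ _ _).comp (by fun_prop)) 1 fun x => by
      rw [norm_gauss_freq]
      simp only [neg_zero, zero_div, zero_mul, Real.exp_zero, one_mul, Real.exp_le_one_iff]
      have := sq_nonneg (x.2 : ℝ)
      have : (0 : ℝ) ≤ p.2 := p.2.cast_nonneg
      nlinarith

theorem charGauss_apply (p : (Fin d → ℝ) × ℕ) (x : EuclideanSpace ℝ (Fin d) × ℝ≥0) :
    charGauss p x = gauss 0 (freq p.1) p.2 (x.1, (x.2 : ℝ)) := rfl

theorem charGauss_mul (p q : (Fin d → ℝ) × ℕ) :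
    charGauss p * charGauss q = charGauss (p + q) := by
  ext x
  simp [charGauss_apply, gauss_mul_gauss, freq_add]

theorem star_charGauss (p : (Fin d → ℝ) × ℕ) : star (charGauss p) = charGauss (-p.1, p.2) := by
  ext x
  simp [charGauss_apply, conj_gauss, star_freq]

theorem charGauss_zero : charGauss (0 : (Fin d → ℝ) × ℕ) = 1 := by
  ext x
  simp [charGauss_apply, gauss, freq]

/-- The functions `charGauss p` form a monoid. -/
def charMonoid (d : ℕ) : Submonoid ((EuclideanSpace ℝ (Fin d) × ℝ≥0) →ᵇ ℂ) where
  carrier := Set.range charGauss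
  mul_mem' := by
    rintro _ _ ⟨p, rfl⟩ ⟨q, rfl⟩
    exact ⟨p + q, (charGauss_mul p q).symm⟩
  one_mem' := ⟨0, charGauss_zero⟩

/-- The generators contain `1` and are closed under products and conjugation, so the star algebra
they generate is their linear span, and equality of integrals extends to it by linearity. -/
theorem mem_span_of_mem_adjoin {g : (EuclideanSpace ℝ (Fin d) × ℝ≥0) →ᵇ ℂ}
    (hg : g ∈ StarAlgebra.adjoin ℂ (Set.range (charGauss (d := d)))) :
    g ∈ Submodule.span ℂ (Set.range (charGauss (d := d))) := by
  have hstar : star (Set.range (charGauss (d := d))) ⊆ Set.range charGauss := by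
    rintro g ⟨p, hp⟩
    exact ⟨(-p.1, p.2), by rw [← star_charGauss, hp, star_star]⟩
  rw [← StarSubalgebra.mem_toSubalgebra, StarAlgebra.adjoin_toSubalgebra,
    Set.union_eq_self_of_subset_right hstar, ← Subalgebra.mem_toSubmodule,
    Algebra.adjoin_eq_span] at hg
  have h : Submonoid.closure (Set.range (charGauss (d := d))) = charMonoid d :=
    (charMonoid d).closure_eq
  rwa [h] at hg

/-- Plane waves separate first coordinates. The Gaussian in the last coordinate sees only its
square, which is why the points are taken with last coordinate in `ℝ≥0`. -/
theorem separatesPoints_charGauss :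
    ((StarAlgebra.adjoin ℂ (Set.range (charGauss (d := d)))).map
      (BoundedContinuousFunction.toContinuousMapStarₐ ℂ)).SeparatesPoints := by
  have key : ∀ p, (fun x => charGauss (d := d) p x) ∈ (fun f : C(_, ℂ) => (f : _ → ℂ)) ''
      (((StarAlgebra.adjoin ℂ (Set.range (charGauss (d := d)))).map
        (BoundedContinuousFunction.toContinuousMapStarₐ ℂ)).toSubalgebra : Set C(_, ℂ)) := fun p =>
    ⟨(BoundedContinuousFunction.toContinuousMapStarₐ ℂ) (charGauss p),
      ⟨_, StarAlgebra.subset_adjoin ℂ _ ⟨p, rfl⟩, rfl⟩, rfl⟩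
  intro x y hxy
  by_cases h2 : x.2 = y.2
  · have h1 : x.1 ≠ y.1 := fun h => hxy (Prod.ext h h2)
    obtain ⟨i, hi⟩ : ∃ i, x.1 i ≠ y.1 i := by
      by_contra! h
      exact h1 (by ext i; exact h i)
    -- With this frequency the values at `x` and `y` have ratio `exp(iπ) = -1`.
    refine ⟨_, key (Pi.single i (Real.pi / (x.1 i - y.1 i)), 0), ?_⟩
    have hd : x.1 i - y.1 i ≠ 0 := sub_ne_zero.2 hi
    have hv : ∀ z : EuclideanSpace ℝ (Fin d) × ℝ≥0,
        charGauss (Pi.single i (Real.pi / (x.1 i - y.1 i)), 0) z =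
        Complex.exp (Complex.I * (Real.pi / (x.1 i - y.1 i) : ℝ) * z.1 i) := by
      intro z
      have hs : ∑ j, freq (Pi.single i (Real.pi / (x.1 i - y.1 i))) j * (z.1 j : ℂ) =
          Complex.I * (Real.pi / (x.1 i - y.1 i) : ℝ) * z.1 i := by
        rw [Finset.sum_eq_single_of_mem i (Finset.mem_univ i)]
        · simp [freq]
        · intro j _ hj
          simp [freq, hj]
      rw [charGauss_apply, gauss]
      simp only [hs]
      simp
    beta_reduce
    rw [hv, hv]
    intro h
    have h3 : Complex.exp (Complex.I * (Real.pi / (x.1 i - y.1 i) : ℝ) * x.1 i -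
        Complex.I * (Real.pi / (x.1 i - y.1 i) : ℝ) * y.1 i) = 1 := by
      rw [Complex.exp_sub, h, div_self (Complex.exp_ne_zero _)]
    have h4 : Complex.I * (Real.pi / (x.1 i - y.1 i) : ℝ) * x.1 i -
        Complex.I * (Real.pi / (x.1 i - y.1 i) : ℝ) * y.1 i = Real.pi * Complex.I := by
      have : (x.1 i - y.1 i : ℂ) ≠ 0 := by
        rw [← Complex.ofReal_sub]
        exact Complex.ofReal_ne_zero.2 hd
      push_cast
      field_simp
    rw [h4, Complex.exp_pi_mul_I] at h3
    norm_num at h3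
  · refine ⟨_, key (0, 1), ?_⟩
    have hv : ∀ z : EuclideanSpace ℝ (Fin d) × ℝ≥0,
        charGauss (0, 1) z = (Real.exp (-1 / 2 * (z.2 : ℝ) ^ 2) : ℝ) := by
      intro z
      simp [charGauss_apply, gauss, freq]
    rw [hv, hv]
    intro h
    have h3 := Real.exp_injective (Complex.ofReal_injective h)
    have h4 : (x.2 : ℝ) ^ 2 = (y.2 : ℝ) ^ 2 := by linarith
    exact h2 (NNReal.coe_injective ((pow_left_inj₀ x.2.2 y.2.2 two_ne_zero).1 h4))

theorem map_map_nnreal {P : Measure (Space d)} (hP : ∀ᵐ x ∂P, 0 ≤ x.2) :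
    (P.map fun x => (x.1, x.2.toNNReal)).map (fun x => (x.1, (x.2 : ℝ))) = P := by
  rw [Measure.map_map (by fun_prop) (by fun_prop)]
  conv_rhs => rw [← Measure.map_id (μ := P)]
  refine Measure.map_congr (hP.mono fun x hx => ?_)
  simp [Real.coe_toNNReal _ hx]

/-- Finite measures on the closed half space with the same integrals of `gauss 0 (i b) n` are
equal. -/
theorem ext_of_integral_gauss_zero {P P' : Measure (Space d)} [IsFiniteMeasure P]
    [IsFiniteMeasure P'] (hP : ∀ᵐ x ∂P, 0 ≤ x.2) (hP' : ∀ᵐ x ∂P', 0 ≤ x.2)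
    (h : ∀ (b : Fin d → ℝ) (n : ℕ),
      ∫ x, gauss 0 (freq b) n x ∂P = ∫ x, gauss 0 (freq b) n x ∂P') : P = P' := by
  have hint : ∀ {Q : Measure (Space d)}, (∀ᵐ x ∂Q, 0 ≤ x.2) → ∀ p : (Fin d → ℝ) × ℕ,
      ∫ x, charGauss p x ∂(Q.map fun x => (x.1, x.2.toNNReal)) =
        ∫ x, gauss 0 (freq p.1) p.2 x ∂Q := by
    intro Q hQ p
    rw [integral_map (by fun_prop) (charGauss p).continuous.aestronglyMeasurable]
    refine integral_congr_ae (hQ.mono fun x hx => ?_)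
    simp [charGauss_apply, Real.coe_toNNReal _ hx]
  have key : (P.map fun x => (x.1, x.2.toNNReal)) = P'.map fun x => (x.1, x.2.toNNReal) := by
    refine ext_of_forall_mem_subalgebra_integral_eq_of_pseudoEMetric_complete_countable
      (𝕜 := ℂ) separatesPoints_charGauss fun g hg => ?_
    refine Submodule.span_induction (p := fun g _ =>
      ∫ x, g x ∂(P.map fun x => (x.1, x.2.toNNReal)) =
        ∫ x, g x ∂(P'.map fun x => (x.1, x.2.toNNReal))) ?_ ?_ ?_ ?_ (mem_span_of_mem_adjoin hg)
    · rintro _ ⟨p, rfl⟩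
      rw [hint hP, hint hP', h]
    · simp
    · intro f g _ _ hf hg
      simp only [BoundedContinuousFunction.coe_add, Pi.add_apply]
      rw [integral_add (f.integrable _) (g.integrable _),
        integral_add (f.integrable _) (g.integrable _), hf, hg]
    · intro c f _ hf
      simp only [BoundedContinuousFunction.coe_smul]
      rw [integral_smul, integral_smul, hf]
  rw [← map_map_nnreal hP, ← map_map_nnreal hP', key]

theorem gauss_one_zero_one (x : Space d) :
    gauss 1 (freq 0) 1 x = (‖gauss 1 (freq 0) 1 x‖ : ℝ) := by
  rw [norm_gauss, freq_zero]
  simp [Pi.zero_def]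

theorem integral_withDensity_gauss {μ : Measure (Space d)} (b : Fin d → ℝ) (n : ℕ) :
    ∫ x, gauss 0 (freq b) n x
      ∂(μ.withDensity fun x => ENNReal.ofReal ‖gauss 1 (freq (0 : Fin d → ℝ)) 1 x‖) =
      ∫ x, gauss 1 (freq b) (n + 1) x ∂μ := by
  rw [integral_withDensity_eq_integral_toReal_smul
    (continuous_gauss _ _ _).norm.measurable.ennreal_ofReal (by simp)]
  refine integral_congr_ae (.of_forall fun x => ?_)
  beta_reduce
  rw [ENNReal.toReal_ofReal (norm_nonneg _), Complex.real_smul, ← gauss_one_zero_one,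
    gauss_mul_gauss, freq_add, zero_add, add_zero, add_comm (1 : ℝ)]

/-- Measures on the closed half space with the same integrals of Gaussians are equal. -/
theorem ext_of_integral_gauss {μ ν : Measure (Space d)}
    (hμ : ∀ᵐ x ∂μ, 0 ≤ x.2) (hν : ∀ᵐ x ∂ν, 0 ≤ x.2)
    (hμi : Integrable (gauss 1 (freq (0 : Fin d → ℝ)) 1) μ)
    (hνi : Integrable (gauss 1 (freq (0 : Fin d → ℝ)) 1) ν)
    (h : ∀ (b : Fin d → ℝ) (t : ℝ), 0 < t →
      ∫ x, gauss 1 (freq b) t x ∂μ = ∫ x, gauss 1 (freq b) t x ∂ν) : μ = ν := by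
  -- This weight makes both measures finite and, being positive and finite everywhere, can be
  -- divided out afterwards. It turns `gauss 0 (freq b) n` into `gauss 1 (freq b) (n + 1)`, so `t =
  -- n + 1` suffices.
  let w : Space d → ℝ≥0∞ := fun x => ENNReal.ofReal ‖gauss 1 (freq (0 : Fin d → ℝ)) 1 x‖
  have hw : Measurable w := (continuous_gauss _ _ _).norm.measurable.ennreal_ofReal
  have hw0 : ∀ x, w x ≠ 0 := fun x => by
    simp only [w, norm_gauss_freq]
    positivity
  have hf : ∀ {Q : Measure (Space d)}, Integrable (gauss 1 (freq (0 : Fin d → ℝ)) 1) Q →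
      IsFiniteMeasure (Q.withDensity w) := fun hQ =>
    isFiniteMeasure_withDensity_ofReal hQ.norm.2
  have := hf hμi
  have := hf hνi
  have key : μ.withDensity w = ν.withDensity w := by
    refine ext_of_integral_gauss_zero ((withDensity_absolutelyContinuous _ _).ae_le hμ)
      ((withDensity_absolutelyContinuous _ _).ae_le hν) fun b n => ?_
    rw [integral_withDensity_gauss, integral_withDensity_gauss, h _ _ (by positivity)]
  have hinv : ∀ Q : Measure (Space d), (Q.withDensity w).withDensity w⁻¹ = Q := fun Q =>
    withDensity_inv_same hw (.of_forall hw0) (.of_forall fun x => by simp [w])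
  rw [← hinv μ, ← hinv ν, key]

/-- The positive and negative parts of `u`, taken as densities, define finite measures with equal
integrals of the test functions. These measures coincide, so the two parts agree almost everywhere;
having disjoint supports, both vanish. -/
theorem ae_eq_zero_of_integral_ofReal_mul_gauss {μ : Measure (Space d)}
    (hμ : ∀ᵐ x ∂μ, 0 ≤ x.2) {u : Space d → ℝ} (hu : Integrable u μ)
    (h : ∀ (b : Fin d → ℝ) (n : ℕ), ∫ x, (u x : ℂ) * gauss 0 (freq b) n x ∂μ = 0) :
    u =ᵐ[μ] 0 := by
  have hf : ∀ {v : Space d → ℝ}, Integrable v μ →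
      IsFiniteMeasure (μ.withDensity fun x => ENNReal.ofReal (v x)) := fun hv =>
    isFiniteMeasure_withDensity_ofReal hv.2
  have := hf hu
  have := hf hu.neg
  have hint : ∀ {v : Space d → ℝ}, Integrable v μ → ∀ (b : Fin d → ℝ) (n : ℕ),
      ∫ x, gauss 0 (freq b) n x ∂(μ.withDensity fun x => ENNReal.ofReal (v x)) =
        ∫ x, ((max (v x) 0 : ℝ) : ℂ) * gauss 0 (freq b) n x ∂μ := by
    intro v hv b n
    rw [integral_withDensity_eq_integral_toReal_smul₀ hv.1.aemeasurable.ennreal_ofReal (by simp)]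
    refine integral_congr_ae (.of_forall fun x => ?_)
    beta_reduce
    rw [ENNReal.toReal_ofReal', Complex.real_smul]
  have hb : ∀ (b : Fin d → ℝ) (n : ℕ) (x : Space d), ‖gauss 0 (freq b) n x‖ ≤ 1 := by
    intro b n x
    rw [norm_gauss_freq]
    simp only [neg_zero, zero_div, zero_mul, Real.exp_zero, one_mul, Real.exp_le_one_iff]
    have := sq_nonneg x.2
    have : (0 : ℝ) ≤ n := n.cast_nonneg
    nlinarith
  have hmi : ∀ {v : Space d → ℝ}, Integrable v μ → ∀ (b : Fin d → ℝ) (n : ℕ),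
      Integrable (fun x => ((max (v x) 0 : ℝ) : ℂ) * gauss 0 (freq b) n x) μ := by
    intro v hv b n
    have : Integrable (fun x => ((max (v x) 0 : ℝ) : ℂ)) μ := Integrable.ofReal hv.pos_part
    exact this.mul_bdd (c := 1) (continuous_gauss _ _ _).aestronglyMeasurable
      (.of_forall fun x => hb b n x)
  have key : (μ.withDensity fun x => ENNReal.ofReal (u x)) =
      μ.withDensity fun x => ENNReal.ofReal ((-u) x) := by
    refine ext_of_integral_gauss_zero ((withDensity_absolutelyContinuous _ _).ae_le hμ)
      ((withDensity_absolutelyContinuous _ _).ae_le hμ) fun b n => ?_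
    rw [hint hu, hint hu.neg, ← sub_eq_zero, ← integral_sub (hmi hu b n) (hmi hu.neg b n),
      ← h b n]
    refine integral_congr_ae (.of_forall fun x => ?_)
    beta_reduce
    rw [← sub_mul, ← Complex.ofReal_sub, Pi.neg_apply]
    congr 2
    rcases le_total (u x) 0 with h0 | h0
    · rw [max_eq_right h0, max_eq_left (by linarith)]; ring
    · rw [max_eq_left h0, max_eq_right (by linarith)]; ring
  have h2 := (withDensity_eq_iff hu.1.aemeasurable.ennreal_ofReal
    hu.neg.1.aemeasurable.ennreal_ofReal (by
      have := measure_lt_top (μ.withDensity fun x => ENNReal.ofReal (u x)) Set.univ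
      rw [withDensity_apply _ MeasurableSet.univ, Measure.restrict_univ] at this
      exact this.ne)).1 key
  refine h2.mono fun x hx => ?_
  simp only [Pi.neg_apply] at hx
  rcases le_total (u x) 0 with h0 | h0
  · rw [ENNReal.ofReal_of_nonpos h0, eq_comm, ENNReal.ofReal_eq_zero] at hx
    simp only [Pi.zero_apply]; linarith
  · rw [ENNReal.ofReal_of_nonpos (by linarith : -u x ≤ 0), ENNReal.ofReal_eq_zero] at hx
    simp only [Pi.zero_apply]; linarith

/-- A function whose integrals against all Gaussians vanish is zero almost everywhere. -/
theorem ae_eq_zero_of_integral_mul_gauss {μ : Measure (Space d)}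
    (hμ : ∀ᵐ x ∂μ, 0 ≤ x.2) {f : Space d → ℂ}
    (hf : ∀ (b : Fin d → ℝ) (t : ℝ), 0 < t → Integrable (fun x => f x * gauss 1 (freq b) t x) μ)
    (h : ∀ (b : Fin d → ℝ) (t : ℝ), 0 < t → ∫ x, f x * gauss 1 (freq b) t x ∂μ = 0) :
    f =ᵐ[μ] 0 := by
  let F : Space d → ℂ := fun x => f x * gauss 1 (freq (0 : Fin d → ℝ)) 1 x
  have hFi : Integrable F μ := hf 0 1 one_pos
  have hprod : ∀ (b : Fin d → ℝ) (n : ℕ) (x : Space d), F x * gauss 0 (freq b) n x =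
      f x * gauss 1 (freq b) (n + 1) x := by
    intro b n x
    simp only [F]
    rw [mul_assoc, gauss_mul_gauss, freq_add, zero_add, add_zero, add_comm (1 : ℝ)]
  have hI : ∀ (b : Fin d → ℝ) (n : ℕ), Integrable (fun x => F x * gauss 0 (freq b) n x) μ := by
    intro b n
    simp_rw [hprod]
    exact hf _ _ (by positivity)
  have h0 : ∀ (b : Fin d → ℝ) (n : ℕ), ∫ x, F x * gauss 0 (freq b) n x ∂μ = 0 := by
    intro b n
    simp_rw [hprod]
    exact h _ _ (by positivity)
  -- Conjugation sends frequency `b` to `-b`, so `conj F` satisfies the same hypotheses, and the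
  -- real and imaginary parts of `F` can be treated separately.
  have hprod' : ∀ (b : Fin d → ℝ) (n : ℕ) (x : Space d),
      starRingEnd ℂ (F x) * gauss 0 (freq b) n x =
        starRingEnd ℂ (F x * gauss 0 (freq (-b)) n x) := by
    intro b n x
    rw [map_mul (starRingEnd ℂ) (F x), conj_gauss, star_freq, neg_neg]
  have hI' : ∀ (b : Fin d → ℝ) (n : ℕ),
      Integrable (fun x => starRingEnd ℂ (F x) * gauss 0 (freq b) n x) μ := by
    intro b n
    simp_rw [hprod']
    exact (LinearIsometryEquiv.integrable_comp_iff Complex.conjLIE).2 (hI _ _)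
  have h0' : ∀ (b : Fin d → ℝ) (n : ℕ),
      ∫ x, starRingEnd ℂ (F x) * gauss 0 (freq b) n x ∂μ = 0 := by
    intro b n
    simp_rw [hprod']
    rw [integral_conj, h0, map_zero]
  have hre : (fun x => (F x).re) =ᵐ[μ] 0 := by
    refine ae_eq_zero_of_integral_ofReal_mul_gauss hμ hFi.re fun b n => ?_
    have : ∀ x, ((F x).re : ℂ) * gauss 0 (freq b) n x = (1 / 2) *
        (F x * gauss 0 (freq b) n x + starRingEnd ℂ (F x) * gauss 0 (freq b) n x) := by
      intro x
      rw [Complex.re_eq_add_conj]; ring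
    simp_rw [this]
    rw [integral_const_mul, integral_add (hI b n) (hI' b n), h0, h0']
    simp
  have him : (fun x => (F x).im) =ᵐ[μ] 0 := by
    refine ae_eq_zero_of_integral_ofReal_mul_gauss hμ hFi.im fun b n => ?_
    have : ∀ x, ((F x).im : ℂ) * gauss 0 (freq b) n x = (1 / (2 * Complex.I)) *
        (F x * gauss 0 (freq b) n x - starRingEnd ℂ (F x) * gauss 0 (freq b) n x) := by
      intro x
      rw [Complex.im_eq_sub_conj]; ring
    simp_rw [this]
    rw [integral_const_mul, integral_sub (hI b n) (hI' b n), h0, h0']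
    simp
  filter_upwards [hre, him] with x h1 h2
  have h3 : F x = 0 := Complex.ext h1 h2
  have h4 : gauss 1 (freq (0 : Fin d → ℝ)) 1 x ≠ 0 := by
    rw [← norm_ne_zero_iff, norm_gauss_freq]
    positivity
  exact (mul_eq_zero.1 h3).resolve_right h4

end Totality

/-! ### Isometries from equal Gram matrices. -/

section Hilbert

theorem norm_linearCombination_eq_of_inner_eq {ι E F : Type*}
    [NormedAddCommGroup E] [InnerProductSpace ℂ E] [NormedAddCommGroup F] [InnerProductSpace ℂ F]
    {u : ι → E} {v : ι → F} (h : ∀ i j, inner ℂ (u i) (u j) = inner ℂ (v i) (v j)) (x : ι →₀ ℂ) :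
    ‖Finsupp.linearCombination ℂ u x‖ = ‖Finsupp.linearCombination ℂ v x‖ := by
  have key : inner ℂ (Finsupp.linearCombination ℂ u x) (Finsupp.linearCombination ℂ u x) =
      inner ℂ (Finsupp.linearCombination ℂ v x) (Finsupp.linearCombination ℂ v x) := by
    simp only [Finsupp.linearCombination_apply, Finsupp.sum, sum_inner, inner_sum, inner_smul_left,
      inner_smul_right, h]
  rw [inner_self_eq_norm_sq_to_K, inner_self_eq_norm_sq_to_K] at key
  have key' : ‖Finsupp.linearCombination ℂ u x‖ ^ 2 = ‖Finsupp.linearCombination ℂ v x‖ ^ 2 := by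
    exact_mod_cast key
  exact (pow_left_inj₀ (norm_nonneg _) (norm_nonneg _) two_ne_zero).1 key'

theorem denseRange_linearCombination {ι E : Type*} [NormedAddCommGroup E] [InnerProductSpace ℂ E]
    [CompleteSpace E] {u : ι → E} (h : ∀ f : E, (∀ i, inner ℂ (u i) f = 0) → f = 0) :
    DenseRange (Finsupp.linearCombination ℂ u) := by
  have h1 : (Submodule.span ℂ (Set.range u))ᗮ = ⊥ := by
    rw [Submodule.eq_bot_iff]
    intro f hf
    refine h f fun i => ?_
    exact (Submodule.mem_orthogonal _ _).1 hf _ (Submodule.subset_span ⟨i, rfl⟩)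
  have h2 := (Submodule.topologicalClosure_eq_top_iff).2 h1
  have h3 : Dense (Submodule.span ℂ (Set.range u) : Set E) :=
    Submodule.dense_iff_topologicalClosure_eq_top.2 h2
  rw [← Finsupp.range_linearCombination] at h3
  exact h3

end Hilbert

/-! ### Plancherel's theorem and inversion for the Weinstein transform. -/

section Plancherel

variable {d : ℕ} {α : ℝ}

theorem ae_mu_nonneg : ∀ᵐ x ∂(mu d α), 0 ≤ x.2 := ae_mu_pos.mono fun _ h => h.le

/-- The constant `t^{-(α+1)} exp(c·c/2)` in the Weinstein transform of a Gaussian. -/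
def gaussCoeff (α : ℝ) (c : Fin d → ℂ) (t : ℝ) : ℂ :=
  (t ^ (-(α + 1)) : ℝ) * Complex.exp ((∑ i, c i ^ 2) / 2)

theorem gaussCoeff_ne_zero {t : ℝ} (ht : 0 < t) (c : Fin d → ℂ) : gaussCoeff α c t ≠ 0 :=
  mul_ne_zero (Complex.ofReal_ne_zero.2 (by positivity)) (Complex.exp_ne_zero _)

theorem conj_gaussCoeff (c : Fin d → ℂ) (t : ℝ) :
    starRingEnd ℂ (gaussCoeff α c t) = gaussCoeff α (star c) t := by
  rw [gaussCoeff, gaussCoeff, map_mul, Complex.conj_ofReal, ← Complex.exp_conj]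
  simp [Complex.conj_ofNat]

/-- The sum of squares changes sign under `c ↦ i c`, and the powers of `t` and `t⁻¹` cancel. This
makes the two transforms of Gaussians mutually inverse. -/
theorem gaussCoeff_mul_gaussCoeff {t : ℝ} (ht : 0 < t) (c : Fin d → ℂ) :
    gaussCoeff α c t * gaussCoeff α (Complex.I • c) t⁻¹ = 1 := by
  rw [gaussCoeff, gaussCoeff, mul_mul_mul_comm, ← Complex.ofReal_mul, ← Complex.exp_add,
    ← Real.mul_rpow ht.le (by positivity), mul_inv_cancel₀ ht.ne', Real.one_rpow]
  simp only [Pi.smul_apply, smul_eq_mul, mul_pow, Complex.I_sq, ← Finset.mul_sum]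
  simp [← add_div]

/-- Completing the square. The width `a = 1` is fixed by the transform, while `c ↦ -i c` and `t ↦
t⁻¹`; hence Gaussians with `a = 1`, complex `c` and `t > 0` form a stable family. -/
theorem integral_gauss_mul_kernel (hα : -(1 / 2 : ℝ) < α) {t : ℝ} (ht : 0 < t)
    (c : Fin d → ℂ) (l : Space d) :
    ∫ x, gauss 1 c t x * kernel α l x ∂(mu d α) =
      gaussCoeff α c t * gauss 1 (-Complex.I • c) t⁻¹ l := by
  simp_rw [gauss_mul_kernel]
  rw [integral_gauss_mul_besselEntire hα one_pos ht, Real.one_rpow, one_mul, gaussCoeff, mul_assoc,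
    gauss, ← mul_assoc (Complex.exp _), ← Complex.exp_add, Complex.ofReal_exp, ← Complex.exp_add]
  congr 2
  have h : ∑ i, (c i - Complex.I * l.1 i) ^ 2 = ∑ i, c i ^ 2 - ∑ i, (l.1 i : ℂ) ^ 2 +
      2 * ∑ i, (-Complex.I • c) i * l.1 i := by
    rw [Finset.mul_sum, ← Finset.sum_sub_distrib, ← Finset.sum_add_distrib]
    refine Finset.sum_congr rfl fun i _ => ?_
    simp only [Pi.smul_apply, smul_eq_mul]
    linear_combination (l.1 i : ℂ) ^ 2 * Complex.I_sq
  rw [h]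
  have ht' : (t : ℂ) ≠ 0 := Complex.ofReal_ne_zero.2 ht.ne'
  push_cast
  field_simp
  ring

theorem integral_gauss_mul_conj_kernel (hα : -(1 / 2 : ℝ) < α) {t : ℝ} (ht : 0 < t)
    (c : Fin d → ℂ) (l : Space d) :
    ∫ x, gauss 1 c t x * starRingEnd ℂ (kernel α l x) ∂(mu d α) =
      gaussCoeff α c t * gauss 1 (Complex.I • c) t⁻¹ l := by
  have h : ∀ x, gauss 1 c t x * starRingEnd ℂ (kernel α l x) =
      starRingEnd ℂ (gauss 1 (star c) t x * kernel α l x) := by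
    intro x
    rw [map_mul, conj_gauss, star_star]
  simp_rw [h]
  rw [integral_conj, integral_gauss_mul_kernel hα ht, map_mul, conj_gaussCoeff, conj_gauss,
    star_star]
  congr 2
  ext i
  simp

/-- Gaussians as elements of `L²_α`. -/
def gaussL2 (hα : -(1 / 2 : ℝ) < α) (p : (Fin d → ℂ) × Set.Ioi (0 : ℝ)) : L2 d α :=
  (memLp_gauss hα one_pos p.2.2 p.1).toLp

theorem coeFn_gaussL2 (hα : -(1 / 2 : ℝ) < α) (p : (Fin d → ℂ) × Set.Ioi (0 : ℝ)) :
    gaussL2 hα p =ᵐ[mu d α] gauss 1 p.1 p.2 := MemLp.coeFn_toLp _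

theorem inner_gaussL2 (hα : -(1 / 2 : ℝ) < α) (p : (Fin d → ℂ) × Set.Ioi (0 : ℝ)) (f : L2 d α) :
    inner ℂ (gaussL2 hα p) f = ∫ x, f x * gauss 1 (star p.1) p.2 x ∂(mu d α) := by
  rw [L2.inner_def]
  refine integral_congr_ae ((coeFn_gaussL2 hα p).mono fun x hx => ?_)
  beta_reduce
  rw [RCLike.inner_apply, hx, conj_gauss]

theorem inner_gaussL2_gaussL2 (hα : -(1 / 2 : ℝ) < α) (p q : (Fin d → ℂ) × Set.Ioi (0 : ℝ)) :
    inner ℂ (gaussL2 hα p) (gaussL2 hα q) =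
      ((2 ^ (-((d : ℝ) / 2)) * ((p.2 : ℝ) + q.2) ^ (-(α + 1)) : ℝ) : ℂ) *
        Complex.exp ((∑ i, (star (p.1 i) + q.1 i) ^ 2) / 4) := by
  rw [inner_gaussL2]
  have h := integral_gauss hα (d := d) (one_add_one_eq_two (R := ℝ) ▸ two_pos : (0 : ℝ) < 1 + 1)
    (add_pos p.2.2 q.2.2) (star p.1 + q.1)
  have h2 : ∫ x, (gaussL2 hα q : L2 d α) x * gauss 1 (star p.1) p.2 x ∂(mu d α) =
      ∫ x, gauss (1 + 1) (star p.1 + q.1) (p.2 + q.2) x ∂(mu d α) := by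
    refine integral_congr_ae ((coeFn_gaussL2 hα q).mono fun x hx => ?_)
    beta_reduce
    rw [hx, mul_comm, gauss_mul_gauss]
  rw [h2, h]
  norm_num

theorem integrable_mul_gauss (hα : -(1 / 2 : ℝ) < α) {f : Space d → ℂ}
    (hf : MemLp f 2 (mu d α)) {t : ℝ} (ht : 0 < t) (c : Fin d → ℂ) :
    Integrable (fun x => f x * gauss 1 c t x) (mu d α) :=
  hf.integrable_mul (memLp_gauss hα one_pos ht c)

theorem eq_zero_of_inner_gaussL2 (hα : -(1 / 2 : ℝ) < α) {f : L2 d α}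
    (h : ∀ p, inner ℂ (gaussL2 hα p) f = 0) : f = 0 := by
  rw [Lp.eq_zero_iff_ae_eq_zero]
  refine ae_eq_zero_of_integral_mul_gauss ae_mu_nonneg
    (fun b t ht => integrable_mul_gauss hα (Lp.memLp f) ht _) fun b t ht => ?_
  rw [← h (star (freq b), ⟨t, ht⟩), inner_gaussL2]
  simp

/-- The Weinstein transforms of the Gaussians. -/
def gaussTransformL2 (hα : -(1 / 2 : ℝ) < α) (p : (Fin d → ℂ) × Set.Ioi (0 : ℝ)) : L2 d α :=
  gaussCoeff α p.1 p.2 • gaussL2 hα (-Complex.I • p.1, ⟨(p.2 : ℝ)⁻¹, Set.mem_Ioi.2 (inv_pos.2 p.2.2)⟩)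

/-- Both Gram matrices are explicit. They agree since `1/p + 1/q = (p + q)/(pq)` and, in each
coordinate, `(u + v)² = 2u² + 2v² - (u - v)²`. -/
theorem inner_gaussTransformL2 (hα : -(1 / 2 : ℝ) < α) (p q : (Fin d → ℂ) × Set.Ioi (0 : ℝ)) :
    inner ℂ (gaussL2 hα p) (gaussL2 hα q) =
      inner ℂ (gaussTransformL2 hα p) (gaussTransformL2 hα q) := by
  rw [gaussTransformL2, gaussTransformL2, inner_smul_left, inner_smul_right,
    inner_gaussL2_gaussL2, inner_gaussL2_gaussL2, conj_gaussCoeff, gaussCoeff, gaussCoeff]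
  have hp : (0 : ℝ) < p.2 := p.2.2
  have hq : (0 : ℝ) < q.2 := q.2.2
  have h1 : ((p.2 : ℝ) + q.2) ^ (-(α + 1)) =
      (p.2 : ℝ) ^ (-(α + 1)) * (q.2 : ℝ) ^ (-(α + 1)) *
        ((p.2 : ℝ)⁻¹ + (q.2 : ℝ)⁻¹) ^ (-(α + 1)) := by
    rw [← Real.mul_rpow hp.le hq.le, ← Real.mul_rpow (by positivity) (by positivity)]
    congr 1
    field_simp
    ring
  have h2 : (∑ i, (star (p.1 i) + q.1 i) ^ 2) / 4 = (∑ i, (star p.1 i) ^ 2) / 2 +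
      (∑ i, q.1 i ^ 2) / 2 +
        (∑ i, (star ((-Complex.I • p.1) i) + (-Complex.I • q.1) i) ^ 2) / 4 := by
    simp only [Finset.sum_div]
    rw [← Finset.sum_add_distrib, ← Finset.sum_add_distrib]
    refine Finset.sum_congr rfl fun i _ => ?_
    simp only [Pi.star_apply, Pi.smul_apply, smul_eq_mul, Complex.star_def, map_mul, map_neg,
      Complex.conj_I]
    linear_combination ((starRingEnd ℂ (p.1 i) - q.1 i) ^ 2 / 4) * (-Complex.I_sq)
  rw [h1, h2, Complex.exp_add, Complex.exp_add]
  push_cast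
  ring

/-- Equal Gram matrices give an isometry between the spans. Both spans are dense: the transformed
Gaussians are nonzero multiples of Gaussians with all parameters attained. -/
theorem exists_isometry_gaussL2 (hα : -(1 / 2 : ℝ) < α) :
    ∃ W : L2 d α ≃ₗᵢ[ℂ] L2 d α, ∀ p, W (gaussL2 hα p) = gaussTransformL2 hα p := by
  have hd1 := denseRange_linearCombination (u := gaussL2 (d := d) hα)
    fun f hf => eq_zero_of_inner_gaussL2 hα hf
  have hd2 := denseRange_linearCombination (u := gaussTransformL2 (d := d) hα) fun f hf => by
    refine eq_zero_of_inner_gaussL2 hα fun p => ?_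
    have hp : (0 : ℝ) < p.2 := p.2.2
    -- The preimage of the parameter `p` under `(c, t) ↦ (-i c, t⁻¹)`.
    have h := hf (Complex.I • p.1, ⟨(p.2 : ℝ)⁻¹, Set.mem_Ioi.2 (inv_pos.2 hp)⟩)
    rw [gaussTransformL2, inner_smul_left] at h
    have h2 := (mul_eq_zero.1 h).resolve_left (by
      rw [conj_gaussCoeff]; exact gaussCoeff_ne_zero (inv_pos.2 hp) _)
    simpa [smul_smul] using h2
  refine ⟨(LinearEquiv.refl ℂ _).extendOfIsometry _ _ hd1 hd2 fun x =>
    (norm_linearCombination_eq_of_inner_eq (inner_gaussTransformL2 hα) x).symm, fun p => ?_⟩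
  have h := LinearEquiv.extendOfIsometry_eq (LinearEquiv.refl ℂ _) _ _ hd1 hd2 (fun x =>
    (norm_linearCombination_eq_of_inner_eq (inner_gaussTransformL2 hα) x).symm)
    (Finsupp.single p 1)
  simpa using h

theorem symm_gaussL2 (hα : -(1 / 2 : ℝ) < α) {W : L2 d α ≃ₗᵢ[ℂ] L2 d α}
    (hW : ∀ p, W (gaussL2 hα p) = gaussTransformL2 hα p) (p : (Fin d → ℂ) × Set.Ioi (0 : ℝ)) :
    W.symm (gaussL2 hα p) =
      gaussCoeff α p.1 p.2 • gaussL2 hα (Complex.I • p.1, ⟨(p.2 : ℝ)⁻¹, Set.mem_Ioi.2 (inv_pos.2 p.2.2)⟩) := by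
  rw [LinearIsometryEquiv.symm_apply_eq, map_smul, hW, gaussTransformL2, smul_smul]
  simp only
  rw [gaussCoeff_mul_gaussCoeff p.2.2]
  simp [smul_smul]

/-- A function given by a bounded continuous integral kernel is identified by its integrals against
Gaussians. -/
theorem ae_eq_of_integral_kernel (hα : -(1 / 2 : ℝ) < α) {K : Space d → Space d → ℂ}
    (hK : Continuous fun p : Space d × Space d => K p.1 p.2) (hK1 : ∀ l x, ‖K l x‖ ≤ 1)
    {f g : Space d → ℂ} (hf : Integrable f (mu d α)) (hg : MemLp g 2 (mu d α))
    (h : ∀ (b : Fin d → ℝ) (t : ℝ), 0 < t →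
      ∫ x, f x * ∫ l, gauss 1 (freq b) t l * K l x ∂(mu d α) ∂(mu d α) =
        ∫ l, g l * gauss 1 (freq b) t l ∂(mu d α)) :
    (fun l => ∫ x, f x * K l x ∂(mu d α)) =ᵐ[mu d α] g := by
  have hprod : ∀ (b : Fin d → ℝ) (t : ℝ), 0 < t → Integrable
      (fun p : Space d × Space d => (gauss 1 (freq b) t p.1 * f p.2) * K p.1 p.2)
      ((mu d α).prod (mu d α)) := fun b t ht =>
    ((integrable_gauss hα one_pos ht (freq b)).mul_prod hf).mul_bdd (c := 1)
      hK.aestronglyMeasurable (.of_forall fun p => hK1 _ _)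
  have hinner : ∀ (b : Fin d → ℝ) (t : ℝ) (l : Space d),
      (∫ x, f x * K l x ∂(mu d α)) * gauss 1 (freq b) t l =
        ∫ x, (gauss 1 (freq b) t l * f x) * K l x ∂(mu d α) := by
    intro b t l
    rw [mul_comm, ← integral_const_mul]
    simp_rw [mul_assoc]
  have hI : ∀ (b : Fin d → ℝ) (t : ℝ), 0 < t → Integrable
      (fun l => (∫ x, f x * K l x ∂(mu d α)) * gauss 1 (freq b) t l) (mu d α) := by
    intro b t ht
    simp_rw [hinner]
    exact (hprod b t ht).integral_prod_left
  have key : (fun l => (∫ x, f x * K l x ∂(mu d α)) - g l) =ᵐ[mu d α] 0 := by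
    refine ae_eq_zero_of_integral_mul_gauss ae_mu_nonneg (fun b t ht => ?_) fun b t ht => ?_
    · simp_rw [sub_mul]
      exact (hI b t ht).sub (integrable_mul_gauss hα hg ht _)
    · simp_rw [sub_mul]
      rw [integral_sub (hI b t ht) (integrable_mul_gauss hα hg ht _), ← h b t ht, sub_eq_zero]
      simp_rw [hinner]
      -- Fubini moves the kernel from `f` onto the Gaussian; this needs `f` in `L¹`.
      rw [integral_integral_swap (hprod b t ht)]
      refine integral_congr_ae (.of_forall fun x => ?_)
      beta_reduce
      rw [← integral_const_mul]
      refine integral_congr_ae (.of_forall fun l => ?_)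
      beta_reduce
      ring
  exact key.mono fun x hx => sub_eq_zero.1 hx

theorem integral_mul_gauss_eq_inner (hα : -(1 / 2 : ℝ) < α) (f : L2 d α) {t : ℝ} (ht : 0 < t)
    (c : Fin d → ℂ) :
    ∫ x, f x * gauss 1 c t x ∂(mu d α) = inner ℂ (gaussL2 hα (star c, ⟨t, ht⟩)) f := by
  rw [inner_gaussL2]
  simp

/-- Paired with a Gaussian, `W f` equals `f` paired with `W.symm` of it by unitarity. That is again
an explicit Gaussian, the same one that the kernel integral produces. -/
theorem isPlancherelExtension_of_gaussL2 (hα : -(1 / 2 : ℝ) < α) {W : L2 d α ≃ₗᵢ[ℂ] L2 d α}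
    (hW : ∀ p, W (gaussL2 hα p) = gaussTransformL2 hα p) : IsPlancherelExtension d α W := by
  intro f hf
  refine (ae_eq_of_integral_kernel hα (K := kernel α) (continuous_kernel hα)
    (norm_kernel_le_one hα) (memLp_one_iff_integrable.1 hf) (Lp.memLp (W f))
    fun b t ht => ?_).symm
  have hk : ∀ x, ∫ l, gauss 1 (freq b) t l * kernel α l x ∂(mu d α) =
      gaussCoeff α (freq b) t * gauss 1 (-Complex.I • freq b) t⁻¹ x := fun x => by
    rw [← integral_gauss_mul_kernel hα ht]
    simp_rw [kernel_comm _ x]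
  simp_rw [hk]
  rw [integral_mul_gauss_eq_inner hα _ ht, ← W.symm.inner_map_map,
    LinearIsometryEquiv.symm_apply_apply, symm_gaussL2 hα hW,
    inner_smul_left, conj_gaussCoeff, star_star, inner_gaussL2, ← integral_const_mul]
  refine integral_congr_ae (.of_forall fun x => ?_)
  have h : star (Complex.I • star (freq b)) = -Complex.I • freq b := by
    ext i; simp
  simp only [h]
  ring

theorem isPlancherelExtension_transformL2 (hα : -(1 / 2 : ℝ) < α) :
    IsPlancherelExtension d α (transformL2 d α) := by
  obtain ⟨W, hW⟩ := exists_isometry_gaussL2 (d := d) hα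
  exact Classical.epsilon_spec ⟨W, isPlancherelExtension_of_gaussL2 hα hW⟩

theorem transformL2_gaussL2 (hα : -(1 / 2 : ℝ) < α) (p : (Fin d → ℂ) × Set.Ioi (0 : ℝ)) :
    transformL2 d α (gaussL2 hα p) = gaussTransformL2 hα p := by
  obtain ⟨W, hW⟩ := exists_isometry_gaussL2 (d := d) hα
  rw [(isPlancherelExtension_transformL2 hα).unique (isPlancherelExtension_of_gaussL2 hα hW), hW]

/-- Fourier inversion: the inverse transform of an integrable element of `L²_α`. -/
theorem transformL2_symm_ae_eq (hα : -(1 / 2 : ℝ) < α) {f : L2 d α}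
    (hf : Integrable f (mu d α)) :
    (transformL2 d α).symm f =ᵐ[mu d α]
      fun x => ∫ l, f l * starRingEnd ℂ (kernel α l x) ∂(mu d α) := by
  have hc : Continuous fun p : Space d × Space d => kernel α p.2 p.1 := by
    simp_rw [fun p : Space d × Space d => kernel_comm (α := α) p.2 p.1]
    exact continuous_kernel hα
  have hc' : Continuous fun p : Space d × Space d => starRingEnd ℂ (kernel α p.2 p.1) :=
    hc.star
  refine (ae_eq_of_integral_kernel hα (K := fun x l => starRingEnd ℂ (kernel α l x)) hc'
    (fun x l => by simpa using norm_kernel_le_one hα l x) hf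
    (Lp.memLp ((transformL2 d α).symm f)) fun b t ht => ?_).symm
  simp_rw [integral_gauss_mul_conj_kernel hα ht]
  have hflip := (transformL2 d α).inner_map_map (gaussL2 hα (star (freq b), ⟨t, ht⟩))
    ((transformL2 d α).symm f)
  rw [integral_mul_gauss_eq_inner hα _ ht, ← hflip,
    LinearIsometryEquiv.apply_symm_apply, transformL2_gaussL2 hα, gaussTransformL2,
    inner_smul_left, conj_gaussCoeff, star_star, inner_gaussL2, ← integral_const_mul]
  refine integral_congr_ae (.of_forall fun x => ?_)
  have h : star (-Complex.I • star (freq b)) = Complex.I • freq b := by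
    ext i; simp
  simp only [h]
  ring

end Plancherel

/-- Makes bilinear pairings continuous in one argument, so that identities between them may be
checked on Gaussians. -/
theorem exists_integral_mul_clm {Ω : Type*} [MeasurableSpace Ω] {ν : Measure Ω} {h : Ω → ℂ}
    (hh : MemLp h 2 ν) : ∃ L : Lp ℂ 2 ν →L[ℂ] ℂ, ∀ f, L f = ∫ ω, f ω * h ω ∂ν := by
  have hs : MemLp (fun ω => star (h ω)) 2 ν := hh.star
  refine ⟨innerSL ℂ hs.toLp, fun f => ?_⟩
  rw [innerSL_apply_apply, L2.inner_def]
  refine integral_congr_ae (hs.coeFn_toLp.mono fun ω hω => ?_)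
  beta_reduce
  rw [RCLike.inner_apply, hω]
  simp

/-! ### Generalized translation and convolution. -/

section Translation

variable {d : ℕ} {α : ℝ}

theorem clm_ext_gaussL2 (hα : -(1 / 2 : ℝ) < α) {L M : L2 d α →L[ℂ] ℂ}
    (h : ∀ p, L (gaussL2 hα p) = M (gaussL2 hα p)) : L = M := by
  have hd := denseRange_linearCombination (u := gaussL2 (d := d) hα)
    fun f hf => eq_zero_of_inner_gaussL2 hα hf
  have key : (L : L2 d α → ℂ) = M := by
    refine hd.equalizer L.continuous M.continuous (funext fun x => ?_)
    simp only [Function.comp_apply, Finsupp.linearCombination_apply, Finsupp.sum, map_sum,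
      map_smul, h]
  exact ContinuousLinearMap.ext fun f => congrFun key f

/-- The point at which the generalized translation at `(-y', y_{d+1})` evaluates its argument. -/
def translationMap (x : Space d) (p : Space d × ℝ) : Space d :=
  (x.1 + -p.1.1, √(x.2 ^ 2 + p.1.2 ^ 2 + 2 * x.2 * p.1.2 * Real.cos p.2))

theorem continuous_translationMap (x : Space d) : Continuous (translationMap x) := by
  unfold translationMap; fun_prop

theorem sq_add_sq_add_mul_cos_nonneg (u v θ : ℝ) :
    0 ≤ u ^ 2 + v ^ 2 + 2 * u * v * Real.cos θ := by
  nlinarith [sq_nonneg (u + v * Real.cos θ), Real.sin_sq_add_cos_sq θ,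
    mul_nonneg (sq_nonneg v) (sq_nonneg (Real.sin θ))]

/-- A Gaussian depends only on the square of the last coordinate, so the square root disappears and
the cross terms separate into a linear factor in `y'` and an exponential in `cos θ`. -/
theorem gauss_translationMap (a : ℝ) (c : Fin d → ℂ) (t : ℝ) (x : Space d) (p : Space d × ℝ) :
    gauss a c t (translationMap x p) =
      gauss a c t x * (gauss a (fun i => a * x.1 i - c i) t p.1 *
        Complex.exp (-(t * x.2 * p.1.2 : ℝ) * (Real.cos p.2 : ℝ))) := by
  simp only [gauss, translationMap, Real.sq_sqrt (sq_add_sq_add_mul_cos_nonneg _ _ _),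
    Complex.ofReal_exp]
  simp only [← Complex.exp_add]
  congr 1
  have h1 : ∑ i, (((x.1 + -p.1.1) i : ℝ) : ℂ) ^ 2 = ∑ i, (x.1 i : ℂ) ^ 2 +
      ∑ i, (p.1.1 i : ℂ) ^ 2 - 2 * ∑ i, (x.1 i : ℂ) * p.1.1 i := by
    rw [Finset.mul_sum, ← Finset.sum_add_distrib, ← Finset.sum_sub_distrib]
    refine Finset.sum_congr rfl fun i _ => ?_
    simp only [PiLp.add_apply, PiLp.neg_apply]
    push_cast
    ring
  have h2 : ∑ i, c i * (((x.1 + -p.1.1) i : ℝ) : ℂ) =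
      ∑ i, c i * (x.1 i : ℂ) - ∑ i, c i * (p.1.1 i : ℂ) := by
    rw [← Finset.sum_sub_distrib]
    refine Finset.sum_congr rfl fun i _ => ?_
    simp only [PiLp.add_apply, PiLp.neg_apply]
    push_cast
    ring
  have h3 : ∑ i, (a * x.1 i - c i) * (p.1.1 i : ℂ) =
      a * ∑ i, (x.1 i : ℂ) * p.1.1 i - ∑ i, c i * (p.1.1 i : ℂ) := by
    rw [Finset.mul_sum, ← Finset.sum_sub_distrib]
    refine Finset.sum_congr rfl fun i _ => ?_
    ring
  rw [h1, h2, h3]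
  push_cast
  ring

theorem integrable_gauss_mul_exp_cos (hα : -(1 / 2 : ℝ) < α) {a t : ℝ} (ha : 0 < a) (ht : 0 < t)
    (c : Fin d → ℂ) (s : ℝ) :
    Integrable (fun p : Space d × ℝ => gauss a c t p.1 *
      Complex.exp (-(s * p.1.2 : ℝ) * (Real.cos p.2 : ℝ))) ((mu d α).prod (angleMeasure α)) := by
  have := isProbabilityMeasure_angleMeasure hα
  have hi := ((integrable_gauss hα ha (half_pos ht) c (d := d)).norm.mul_const
    (Real.exp (s ^ 2 / t))).comp_fst (angleMeasure α)
  refine hi.mono' ?_ (.of_forall fun p => ?_)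
  · have := continuous_gauss a c t (d := d)
    exact (by fun_prop : Continuous fun p : Space d × ℝ => gauss a c t p.1 *
      Complex.exp (-(s * p.1.2 : ℝ) * (Real.cos p.2 : ℝ))).aestronglyMeasurable
  · have h1 : gauss a c t p.1 = gauss a c (t / 2) p.1 * (Real.exp (-t / 4 * p.1.2 ^ 2) : ℝ) := by
      simp only [gauss]
      rw [mul_assoc, ← Complex.ofReal_mul, ← Real.exp_add]
      congr 4
      ring
    rw [h1, norm_mul, norm_mul, mul_assoc, Complex.norm_real, Real.norm_eq_abs, Real.abs_exp,
      ← Complex.ofReal_neg, ← Complex.ofReal_mul, ← Complex.ofReal_exp, Complex.norm_real,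
      Real.norm_eq_abs, Real.abs_exp, ← Real.exp_add]
    refine mul_le_mul_of_nonneg_left (Real.exp_le_exp.2 ?_) (norm_nonneg _)
    have h2 : -(s * p.1.2) * Real.cos p.2 ≤ |s * p.1.2| := by
      refine (le_abs_self _).trans ?_
      rw [abs_mul, abs_neg]
      exact mul_le_of_le_one_right (abs_nonneg _) (Real.abs_cos_le_one _)
    -- Young's inequality: the part `exp(-t y²/4)` split off from the Gaussian absorbs the growth of
    -- the exponential.
    have h3 : |s * p.1.2| ≤ t / 4 * p.1.2 ^ 2 + s ^ 2 / t := by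
      have h4 : t / 4 * p.1.2 ^ 2 + s ^ 2 / t - |s| * |p.1.2| = (t / 2 * |p.1.2| - |s|) ^ 2 / t := by
        rw [← sq_abs s, ← sq_abs p.1.2]
        field_simp
        ring
      rw [abs_mul]
      have : 0 ≤ (t / 2 * |p.1.2| - |s|) ^ 2 / t := by positivity
      linarith
    linarith

/-- Integrating the angle first yields `besselEntire α ((s y)²)` by Poisson's formula, then the
Gaussian formula applies with `w = s²`. -/
theorem integral_gauss_mul_exp_cos (hα : -(1 / 2 : ℝ) < α) {a t : ℝ} (ha : 0 < a) (ht : 0 < t)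
    (c : Fin d → ℂ) (s : ℝ) :
    ∫ p : Space d × ℝ, gauss a c t p.1 *
      Complex.exp (-(s * p.1.2 : ℝ) * (Real.cos p.2 : ℝ)) ∂((mu d α).prod (angleMeasure α)) =
      ((a ^ (-((d : ℝ) / 2)) * t ^ (-(α + 1)) : ℝ) : ℂ) *
        Complex.exp ((∑ i, c i ^ 2) / (2 * a) + (s : ℂ) ^ 2 / (2 * t)) := by
  have := isProbabilityMeasure_angleMeasure hα
  rw [integral_prod _ (integrable_gauss_mul_exp_cos hα ha ht c s),
    ← integral_gauss_mul_besselEntire hα ha ht]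
  refine integral_congr_ae (.of_forall fun y => ?_)
  dsimp only
  rw [integral_const_mul, integral_exp_mul_cos_angleMeasure hα]
  congr 2
  push_cast
  ring

/-- The integral of a translated Gaussian is explicit, and its dependence on `x` cancels. Since
Gaussian integrals determine the measure, the image measure is `mu`. -/
theorem measurePreserving_translationMap (hα : -(1 / 2 : ℝ) < α) (x : Space d) :
    MeasurePreserving (translationMap x) ((mu d α).prod (angleMeasure α)) (mu d α) := by
  have hm := (continuous_translationMap x).measurable
  have hint : ∀ (b : Fin d → ℝ) (t : ℝ), 0 < t →
      Integrable (fun p => gauss 1 (freq b) t (translationMap x p))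
        ((mu d α).prod (angleMeasure α)) := by
    intro b t ht
    simp_rw [gauss_translationMap]
    exact (integrable_gauss_mul_exp_cos hα one_pos ht _ (t * x.2)).const_mul _
  refine ⟨hm, ext_of_integral_gauss ?_ ae_mu_nonneg ?_ (integrable_gauss hα one_pos one_pos _)
    fun b t ht => ?_⟩
  · rw [ae_map_iff hm.aemeasurable (measurableSet_le measurable_const measurable_snd)]
    exact .of_forall fun p => Real.sqrt_nonneg _
  · rw [integrable_map_measure (continuous_gauss _ _ _).aestronglyMeasurable hm.aemeasurable]
    exact hint 0 1 one_pos
  · rw [integral_map hm.aemeasurable (continuous_gauss _ _ _).aestronglyMeasurable]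
    simp_rw [gauss_translationMap]
    rw [integral_const_mul, integral_gauss_mul_exp_cos hα one_pos ht, integral_gauss hα one_pos ht,
      mul_left_comm]
    congr 1
    simp only [gauss, Complex.ofReal_exp]
    rw [← Complex.exp_add, ← Complex.exp_add]
    congr 1
    have h : ∑ i, (((1 : ℝ) : ℂ) * x.1 i - freq b i) ^ 2 = ∑ i, (x.1 i : ℂ) ^ 2 -
        2 * ∑ i, freq b i * x.1 i + ∑ i, freq b i ^ 2 := by
      rw [Finset.mul_sum, ← Finset.sum_sub_distrib, ← Finset.sum_add_distrib]
      refine Finset.sum_congr rfl fun i _ => ?_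
      push_cast
      ring
    rw [h]
    have ht' : (t : ℂ) ≠ 0 := Complex.ofReal_ne_zero.2 ht.ne'
    push_cast
    field_simp
    ring

/-- On the product space both factors are in `L²`, as the angle has total mass one. This gives
absolute convergence of the convolution at every `x`, not just almost every one. -/
theorem integrable_translationMap_mul (hα : -(1 / 2 : ℝ) < α) {f g : Space d → ℂ}
    (hf : MemLp f 2 (mu d α)) (hg : MemLp g 2 (mu d α)) (x : Space d) :
    Integrable (fun p => f (translationMap x p) * g p.1) ((mu d α).prod (angleMeasure α)) :=
  have := isProbabilityMeasure_angleMeasure hα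
  (hf.comp_measurePreserving (measurePreserving_translationMap hα x)).integrable_mul
    (hg.comp_fst (angleMeasure α))

theorem translation_reflect (hα : -(1 / 2 : ℝ) < α) (f : Space d → ℂ) (x y : Space d) :
    translation α x f (reflect y) = ∫ θ, f (translationMap x (y, θ)) ∂(angleMeasure α) := by
  rw [integral_angleMeasure hα]
  rfl

theorem convConvergesAt (hα : -(1 / 2 : ℝ) < α) {f g : Space d → ℂ}
    (hf : MemLp f 2 (mu d α)) (hg : MemLp g 2 (mu d α)) (x : Space d) :
    ConvConvergesAt α f g x := by
  have := isProbabilityMeasure_angleMeasure hα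
  constructor
  -- Pairing with a Gaussian gives integrability on the product space; the Gaussian never vanishes
  -- and is constant in `θ`, so it can be divided out on each fibre.
  · have h := (integrable_translationMap_mul hα hf
      (memLp_gauss hα one_pos one_pos (freq 0)) x).prod_right_ae
    refine h.mono fun y hy => ?_
    have h0 : gauss 1 (freq (0 : Fin d → ℝ)) 1 y ≠ 0 := by
      rw [← norm_ne_zero_iff, norm_gauss_freq]
      positivity
    have hy' := hy.mul_const (gauss 1 (freq (0 : Fin d → ℝ)) 1 y)⁻¹
    simp only [mul_assoc, mul_inv_cancel₀ h0, mul_one] at hy'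
    exact (integrable_angleMeasure_iff hα _).1 hy'
  · have h := (integrable_translationMap_mul hα hf hg x).integral_prod_left
    refine h.congr (.of_forall fun y => ?_)
    beta_reduce
    rw [translation_reflect hα]
    exact integral_mul_const (g y) fun θ => f (translationMap x (y, θ))

theorem conv_eq_integral_prod (hα : -(1 / 2 : ℝ) < α) {f g : Space d → ℂ}
    (hf : MemLp f 2 (mu d α)) (hg : MemLp g 2 (mu d α)) (x : Space d) :
    conv α f g x =
      ∫ p, f (translationMap x p) * g p.1 ∂((mu d α).prod (angleMeasure α)) := by
  have := isProbabilityMeasure_angleMeasure hα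
  rw [integral_prod _ (integrable_translationMap_mul hα hf hg x), conv]
  refine integral_congr_ae (.of_forall fun y => ?_)
  beta_reduce
  rw [translation_reflect hα]
  exact (integral_mul_const (g y) fun θ => f (translationMap x (y, θ))).symm

theorem memLp_mul_conj_kernel (hα : -(1 / 2 : ℝ) < α) {f : Space d → ℂ}
    (hf : MemLp f 2 (mu d α)) (x : Space d) :
    MemLp (fun l => f l * starRingEnd ℂ (kernel α l x)) 2 (mu d α) := by
  have hc : Continuous fun l : Space d => kernel α l x := by
    have := continuous_besselj hα
    unfold kernel
    fun_prop
  refine hf.mono (hf.1.mul hc.star.aestronglyMeasurable) (.of_forall fun l => ?_)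
  rw [norm_mul, RCLike.norm_conj]
  exact mul_le_of_le_one_right (norm_nonneg _) (norm_kernel_le_one hα _ _)

/-- The convolution formula for two Gaussians: both sides are closed expressions, matched by `hpow`
on the powers and `hexp` on the exponents. -/
theorem integral_gauss_translationMap (hα : -(1 / 2 : ℝ) < α) {t t' : ℝ} (ht : 0 < t)
    (ht' : 0 < t') (c c' : Fin d → ℂ) (x : Space d) :
    ∫ p, gauss 1 c t (translationMap x p) * gauss 1 c' t' p.1
      ∂((mu d α).prod (angleMeasure α)) =
    gaussCoeff α c t * gaussCoeff α c' t' * ∫ l, gauss 1 (-Complex.I • c) t⁻¹ l *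
      gauss 1 (-Complex.I • c') t'⁻¹ l * starRingEnd ℂ (kernel α l x) ∂(mu d α) := by
  have h1 : ∀ p : Space d × ℝ, gauss 1 c t (translationMap x p) * gauss 1 c' t' p.1 =
      gauss 1 c t x * (gauss (1 + 1) ((fun i => (1 : ℝ) * x.1 i - c i) + c') (t + t') p.1 *
        Complex.exp (-(t * x.2 * p.1.2 : ℝ) * (Real.cos p.2 : ℝ))) := by
    intro p
    rw [gauss_translationMap, ← gauss_mul_gauss]
    ring
  simp_rw [h1, kernel_comm _ x, gauss_mul_gauss, gauss_mul_conj_kernel]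
  have hti := inv_pos.2 ht
  have hti' := inv_pos.2 ht'
  rw [integral_const_mul, integral_gauss_mul_exp_cos hα (by norm_num) (by positivity),
    integral_gauss_mul_besselEntire hα (by norm_num) (by positivity), gaussCoeff, gaussCoeff]
  have hpow : (t + t') ^ (-(α + 1)) =
      t ^ (-(α + 1)) * t' ^ (-(α + 1)) * (t⁻¹ + t'⁻¹) ^ (-(α + 1)) := by
    rw [← Real.mul_rpow ht.le ht'.le, ← Real.mul_rpow (by positivity) (by positivity)]
    congr 1
    field_simp
    ring
  have hexp : gauss 1 c t x * Complex.exp ((∑ i, (((fun i => ((1 : ℝ) : ℂ) * x.1 i - c i) + c') i) ^ 2) /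
        (2 * ((1 + 1 : ℝ) : ℂ)) + ((t * x.2 : ℝ) : ℂ) ^ 2 / (2 * ((t + t' : ℝ) : ℂ))) =
      Complex.exp ((∑ i, c i ^ 2) / 2) * Complex.exp ((∑ i, c' i ^ 2) / 2) *
        Complex.exp ((∑ i, ((-Complex.I • c + -Complex.I • c') i + Complex.I * x.1 i) ^ 2) /
          (2 * ((1 + 1 : ℝ) : ℂ)) + -(x.2 : ℂ) ^ 2 / (2 * ((t⁻¹ + t'⁻¹ : ℝ) : ℂ))) := by
    simp only [gauss, Complex.ofReal_exp, ← Complex.exp_add]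
    congr 1
    have h2 : -((1 : ℝ) : ℂ) / 2 * ∑ i, (x.1 i : ℂ) ^ 2 + ∑ i, c i * (x.1 i : ℂ) +
        (∑ i, (((fun i => ((1 : ℝ) : ℂ) * x.1 i - c i) + c') i) ^ 2) / (2 * ((1 + 1 : ℝ) : ℂ)) =
        (∑ i, c i ^ 2) / 2 + (∑ i, c' i ^ 2) / 2 +
        (∑ i, ((-Complex.I • c + -Complex.I • c') i + Complex.I * x.1 i) ^ 2) /
          (2 * ((1 + 1 : ℝ) : ℂ)) := by
      rw [Finset.mul_sum]
      simp only [Finset.sum_div, ← Finset.sum_add_distrib]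
      refine Finset.sum_congr rfl fun i _ => ?_
      simp only [Pi.add_apply, Pi.smul_apply, smul_eq_mul]
      push_cast
      linear_combination (-(c i + c' i - x.1 i) ^ 2 / 4) * Complex.I_sq
    have h3 : ((-t / 2 * x.2 ^ 2 : ℝ) : ℂ) + ((t * x.2 : ℝ) : ℂ) ^ 2 / (2 * ((t + t' : ℝ) : ℂ)) =
        -(x.2 : ℂ) ^ 2 / (2 * ((t⁻¹ + t'⁻¹ : ℝ) : ℂ)) := by
      rw [← Complex.ofReal_pow, ← Complex.ofReal_pow]
      norm_cast
      have : t + t' ≠ 0 := by positivity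
      field_simp
      ring
    linear_combination h2 + h3
  rw [hpow, mul_left_comm, ← mul_assoc, mul_assoc _ (gauss 1 c t x), mul_left_comm]
  simp only [Complex.ofReal_mul] at hexp ⊢
  linear_combination ((1 + 1 : ℝ) ^ (-((d : ℝ) / 2)) : ℝ) * ((t ^ (-(α + 1)) : ℝ) : ℂ) *
    ((t' ^ (-(α + 1)) : ℝ) : ℂ) * (((t⁻¹ + t'⁻¹) ^ (-(α + 1)) : ℝ) : ℂ) * hexp

theorem coeFn_transformL2_gaussL2 (hα : -(1 / 2 : ℝ) < α)
    (p : (Fin d → ℂ) × Set.Ioi (0 : ℝ)) :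
    transformL2 d α (gaussL2 hα p) =ᵐ[mu d α]
      fun l => gaussCoeff α p.1 p.2 * gauss 1 (-Complex.I • p.1) (p.2 : ℝ)⁻¹ l := by
  rw [transformL2_gaussL2 hα, gaussTransformL2]
  filter_upwards [Lp.coeFn_smul (gaussCoeff α p.1 p.2)
    (gaussL2 hα (-Complex.I • p.1, ⟨(p.2 : ℝ)⁻¹, Set.mem_Ioi.2 (inv_pos.2 p.2.2)⟩)),
    coeFn_gaussL2 hα (-Complex.I • p.1, ⟨(p.2 : ℝ)⁻¹, Set.mem_Ioi.2 (inv_pos.2 p.2.2)⟩)]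
    with l h1 h2
  rw [h1, Pi.smul_apply, h2, smul_eq_mul]

/-- The generalized convolution of square integrable functions on the transform side. -/
theorem conv_eq_integral_transformL2 (hα : -(1 / 2 : ℝ) < α) (f g : L2 d α) (x : Space d) :
    conv α f g x = ∫ l, transformL2 d α f l *
      (transformL2 d α g l * starRingEnd ℂ (kernel α l x)) ∂(mu d α) := by
  have := isProbabilityMeasure_angleMeasure hα
  have hmp := measurePreserving_translationMap hα x
  have hfst : MeasurePreserving Prod.fst ((mu d α).prod (angleMeasure α)) (mu d α) :=
    measurePreserving_fst
  rw [conv_eq_integral_prod hα (Lp.memLp f) (Lp.memLp g)]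
  -- For fixed `g` both sides are continuous linear in `f`, the left one because composition with a
  -- measure-preserving map is an isometry of `L²`. So Gaussians suffice for `f`, and likewise for
  -- `g`.
  have reduce_left : ∀ g : L2 d α, (∀ p, ∫ q, (gaussL2 hα p : L2 d α) (translationMap x q) * g q.1
        ∂((mu d α).prod (angleMeasure α)) =
      ∫ l, transformL2 d α (gaussL2 hα p) l *
        (transformL2 d α g l * starRingEnd ℂ (kernel α l x)) ∂(mu d α)) → ∀ f : L2 d α,
      ∫ q, f (translationMap x q) * g q.1 ∂((mu d α).prod (angleMeasure α)) =
      ∫ l, transformL2 d α f l *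
        (transformL2 d α g l * starRingEnd ℂ (kernel α l x)) ∂(mu d α) := by
    intro g h f
    obtain ⟨L, hL⟩ := exists_integral_mul_clm ((Lp.memLp g).comp_measurePreserving hfst)
    obtain ⟨M, hM⟩ := exists_integral_mul_clm
      (memLp_mul_conj_kernel hα (Lp.memLp (transformL2 d α g)) x)
    have e1 : ∀ f : L2 d α, L (Lp.compMeasurePreservingₗᵢ ℂ (translationMap x) hmp f) =
        ∫ q, f (translationMap x q) * g q.1 ∂((mu d α).prod (angleMeasure α)) := fun f => by
      rw [hL]
      exact integral_congr_ae ((Lp.coeFn_compMeasurePreserving f hmp).mono fun q hq =>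
        congrArg (· * g q.1) hq)
    have e2 := clm_ext_gaussL2 hα
      (L := L.comp (Lp.compMeasurePreservingₗᵢ ℂ (translationMap x) hmp).toContinuousLinearMap)
      (M := M.comp (transformL2 d α).toContinuousLinearEquiv.toContinuousLinearMap) fun p => by
        refine (e1 _).trans ((h p).trans (hM _).symm)
    rw [← e1]
    exact (DFunLike.congr_fun e2 f).trans (hM _)
  have reduce_right : ∀ f : L2 d α, (∀ p, ∫ q, f (translationMap x q) * (gaussL2 hα p : L2 d α) q.1
        ∂((mu d α).prod (angleMeasure α)) =
      ∫ l, transformL2 d α f l *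
        (transformL2 d α (gaussL2 hα p) l * starRingEnd ℂ (kernel α l x)) ∂(mu d α)) →
      ∀ g : L2 d α,
      ∫ q, f (translationMap x q) * g q.1 ∂((mu d α).prod (angleMeasure α)) =
      ∫ l, transformL2 d α f l *
        (transformL2 d α g l * starRingEnd ℂ (kernel α l x)) ∂(mu d α) := by
    intro f h g
    obtain ⟨L, hL⟩ := exists_integral_mul_clm ((Lp.memLp f).comp_measurePreserving hmp)
    obtain ⟨M, hM⟩ := exists_integral_mul_clm
      (memLp_mul_conj_kernel hα (Lp.memLp (transformL2 d α f)) x)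
    have e1 : ∀ g : L2 d α, L (Lp.compMeasurePreservingₗᵢ ℂ Prod.fst hfst g) =
        ∫ q, f (translationMap x q) * g q.1 ∂((mu d α).prod (angleMeasure α)) := fun g => by
      rw [hL]
      exact integral_congr_ae ((Lp.coeFn_compMeasurePreserving g hfst).mono fun q hq =>
        (congrArg (· * f (translationMap x q)) hq).trans (mul_comm _ _))
    have e1' : ∀ g : L2 d α, M (transformL2 d α g) = ∫ l, transformL2 d α f l *
        (transformL2 d α g l * starRingEnd ℂ (kernel α l x)) ∂(mu d α) := fun g => by
      rw [hM]
      exact integral_congr_ae (.of_forall fun l => mul_left_comm _ _ _)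
    have e2 := clm_ext_gaussL2 hα
      (L := L.comp (Lp.compMeasurePreservingₗᵢ ℂ Prod.fst hfst).toContinuousLinearMap)
      (M := M.comp (transformL2 d α).toContinuousLinearEquiv.toContinuousLinearMap) fun p =>
        (e1 _).trans ((h p).trans (e1' _).symm)
    rw [← e1, ← e1']
    exact DFunLike.congr_fun e2 g
  refine reduce_right f (fun q => reduce_left _ (fun p => ?_) f) g
  have h1 : ∫ z, (gaussL2 hα p : L2 d α) (translationMap x z) * (gaussL2 hα q : L2 d α) z.1
      ∂((mu d α).prod (angleMeasure α)) = ∫ z, gauss 1 p.1 p.2 (translationMap x z) *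
        gauss 1 q.1 q.2 z.1 ∂((mu d α).prod (angleMeasure α)) := by
    refine integral_congr_ae ?_
    filter_upwards [hmp.quasiMeasurePreserving.ae (coeFn_gaussL2 hα p),
      hfst.quasiMeasurePreserving.ae (coeFn_gaussL2 hα q)] with z hz1 hz2
    rw [hz1, hz2]
  rw [h1, integral_gauss_translationMap hα p.2.2 q.2.2, ← integral_const_mul]
  refine integral_congr_ae ?_
  filter_upwards [coeFn_transformL2_gaussL2 hα p, coeFn_transformL2_gaussL2 hα q] with l hp hq
  rw [hp, hq]
  ring

end Translation

/-! ### Dilations and independence of the representative of `m`. -/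

section Dilation

variable {d : ℕ} {α : ℝ}

/-- The factor by which the dilation by `σ` rescales `mu`. -/
def dilationConst (d : ℕ) (α σ : ℝ) : ℝ := (σ ^ 2) ^ (-((d : ℝ) / 2)) * (σ ^ 2) ^ (-(α + 1))

theorem dilationConst_nonneg (σ : ℝ) : 0 ≤ dilationConst d α σ := by
  unfold dilationConst; positivity

theorem continuousOn_dilationConst : ContinuousOn (dilationConst d α) (Set.Ioi 0) := by
  have h : ∀ σ ∈ Set.Ioi (0 : ℝ), σ ^ 2 ≠ 0 ∨ False := fun σ hσ =>
    Or.inl (pow_ne_zero 2 (ne_of_gt hσ))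
  unfold dilationConst
  exact (ContinuousOn.rpow_const (by fun_prop) fun σ hσ => (h σ hσ).imp_right False.elim).mul
    (ContinuousOn.rpow_const (by fun_prop) fun σ hσ => (h σ hσ).imp_right False.elim)

theorem gauss_smul (a : ℝ) (c : Fin d → ℂ) (t σ : ℝ) (x : Space d) :
    gauss a c t (σ • x) = gauss (σ ^ 2 * a) (fun i => σ * c i) (σ ^ 2 * t) x := by
  simp only [gauss, Prod.smul_fst, Prod.smul_snd, PiLp.smul_apply, smul_eq_mul,
    Complex.ofReal_mul, mul_pow, ← Finset.mul_sum]
  congr 2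
  · rw [show ∑ i, c i * ((σ : ℂ) * x.1 i) = ∑ i, (σ : ℂ) * c i * x.1 i from
      Finset.sum_congr rfl fun i _ => by ring]
    push_cast
    ring
  · congr 1
    ring

/-- Dilating a Gaussian multiplies `a` and `t` by `σ²`, so its integral is rescaled by a factor
independent of the Gaussian; such integrals determine the measure. -/
theorem map_smul_mu (hα : -(1 / 2 : ℝ) < α) {σ : ℝ} (hσ : 0 < σ) :
    (mu d α).map (fun x => σ • x) = ENNReal.ofReal (dilationConst d α σ) • mu d α := by
  have hm : Measurable fun x : Space d => σ • x := measurable_const_smul σ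
  have hσ2 : 0 < σ ^ 2 := by positivity
  refine ext_of_integral_gauss ?_ ((Measure.smul_absolutelyContinuous).ae_le ae_mu_nonneg) ?_
    ((integrable_gauss hα one_pos one_pos _).smul_measure ENNReal.ofReal_ne_top) fun b t ht => ?_
  · rw [ae_map_iff hm.aemeasurable (measurableSet_le measurable_const measurable_snd)]
    exact ae_mu_nonneg.mono fun x hx => mul_nonneg hσ.le hx
  · rw [integrable_map_measure (continuous_gauss _ _ _).aestronglyMeasurable hm.aemeasurable]
    refine (integrable_gauss hα (by positivity : 0 < σ ^ 2 * 1) (by positivity : 0 < σ ^ 2 * 1)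
      _).congr (.of_forall fun x => (gauss_smul _ _ _ _ _).symm)
  · rw [integral_map hm.aemeasurable (continuous_gauss _ _ _).aestronglyMeasurable,
      integral_smul_measure, ENNReal.toReal_ofReal (dilationConst_nonneg σ)]
    simp_rw [gauss_smul]
    rw [integral_gauss hα (by positivity) (by positivity), integral_gauss hα one_pos ht,
      dilationConst, Complex.real_smul, ← mul_assoc, ← Complex.ofReal_mul,
      Real.mul_rpow hσ2.le ht.le, mul_one, Real.one_rpow, one_mul, mul_assoc]
    congr 2
    simp only [mul_pow, ← Finset.mul_sum]
    have : (σ : ℂ) ≠ 0 := Complex.ofReal_ne_zero.2 hσ.ne'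
    push_cast
    field_simp

theorem lintegral_smul_mu (hα : -(1 / 2 : ℝ) < α) {σ : ℝ} (hσ : 0 < σ) {f : Space d → ℝ≥0∞}
    (hf : Measurable f) :
    ∫⁻ x, f (σ • x) ∂(mu d α) = ENNReal.ofReal (dilationConst d α σ) * ∫⁻ x, f x ∂(mu d α) := by
  rw [← lintegral_map hf (measurable_const_smul σ), map_smul_mu hα hσ, lintegral_smul_measure,
    smul_eq_mul]

theorem quasiMeasurePreserving_smul (hα : -(1 / 2 : ℝ) < α) {σ : ℝ} (hσ : 0 < σ) :
    Measure.QuasiMeasurePreserving (fun x : Space d => σ • x) (mu d α) (mu d α) :=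
  ⟨measurable_const_smul σ, by
    rw [map_smul_mu hα hσ]
    exact Measure.smul_absolutelyContinuous⟩

theorem dilate_congr (hα : -(1 / 2 : ℝ) < α) {σ : ℝ} (hσ : 0 < σ) {m n : Space d → ℂ}
    (h : m =ᵐ[mu d α] n) : dilate m σ =ᵐ[mu d α] dilate n σ :=
  (quasiMeasurePreserving_smul hα hσ).ae h

theorem memLp_dilate (hα : -(1 / 2 : ℝ) < α) {σ : ℝ} (hσ : 0 < σ) {m : Space d → ℂ}
    (h : MemLp m 2 (mu d α)) : MemLp (dilate m σ) 2 (mu d α) := by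
  have h2 : MemLp m 2 ((mu d α).map fun x => σ • x) := by
    rw [map_smul_mu hα hσ]
    exact h.smul_measure ENNReal.ofReal_ne_top
  exact h2.comp_of_map (measurable_const_smul σ).aemeasurable

theorem toL2_of_memLp {f : Space d → ℂ} (h : MemLp f 2 (mu d α)) : toL2 α f = h.toLp f := by
  classical
  simp only [toL2, dif_pos h]

theorem coeFn_toL2 {f : Space d → ℂ} (h : MemLp f 2 (mu d α)) : toL2 α f =ᵐ[mu d α] f := by
  rw [toL2_of_memLp h]
  exact h.coeFn_toLp

theorem toL2_congr {f g : Space d → ℂ} (h : f =ᵐ[mu d α] g) : toL2 α f = toL2 α g := by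
  by_cases hf : MemLp f 2 (mu d α)
  · rw [toL2_of_memLp hf, toL2_of_memLp (hf.ae_eq h)]
    exact MemLp.toLp_congr _ _ h
  · have hg : ¬ MemLp g 2 (mu d α) := fun hg => hf (hg.ae_eq h.symm)
    simp only [toL2, dif_neg hf, dif_neg hg]

theorem calderonIntegrand_congr (hα : -(1 / 2 : ℝ) < α) {σ : ℝ} (hσ : 0 < σ) {m n : Space d → ℂ}
    (h : m =ᵐ[mu d α] n) (φ : Space d → ℂ) (x : Space d) :
    calderonIntegrand α m φ x σ = calderonIntegrand α n φ x σ := by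
  have hd := dilate_congr hα hσ h
  have e1 : (fun x => dilate m σ x * transformL2 d α (toL2 α φ) x) =ᵐ[mu d α]
      fun x => dilate n σ x * transformL2 d α (toL2 α φ) x := by
    filter_upwards [hd] with x hx
    rw [hx]
  have e2 : (fun x => starRingEnd ℂ (dilate m σ x)) =ᵐ[mu d α]
      fun x => starRingEnd ℂ (dilate n σ x) := by
    filter_upwards [hd] with x hx
    rw [hx]
  have h1 : multiplierOp α m σ φ = multiplierOp α n σ φ := by
    rw [multiplierOp, multiplierOp, toL2_congr e1]
  have h2 : dualWavelet α m σ = dualWavelet α n σ := by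
    rw [dualWavelet, dualWavelet, toL2_congr e2]
  rw [calderonIntegrand, calderonIntegrand, h1, h2]

theorem calderon_congr (hα : -(1 / 2 : ℝ) < α) {m n : Space d → ℂ}
    (h : m =ᵐ[mu d α] n) (φ : Space d → ℂ) {γ δ : ℝ} (hγ : 0 < γ) (hδ : γ < δ) :
    calderon α m φ γ δ = calderon α n φ γ δ := by
  ext x
  refine intervalIntegral.integral_congr fun σ hσ => ?_
  rw [Set.uIcc_of_le hδ.le] at hσ
  exact calderonIntegrand_congr hα (hγ.trans_le hσ.1) h φ x

/-- Dilations preserve null sets, so for each `σ > 0` the functions agree at `σ x` for almost every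
`x`. Tonelli turns this into agreement for almost every `σ` at almost every `x`. -/
theorem Admissible.congr (hα : -(1 / 2 : ℝ) < α) {m n : Space d → ℂ} (h : m =ᵐ[mu d α] n)
    (hm : Admissible α m) : Admissible α n := by
  -- The exceptional set need not be measurable, and the exchange of quantifiers requires a
  -- measurable one.
  obtain ⟨N, hsub, hN, hN0⟩ := exists_measurable_superset_of_null
    (show mu d α {x | m x ≠ n x} = 0 from h)
  have h1 : ∀ᵐ σ ∂(volume.restrict (Set.Ioi (0 : ℝ))), ∀ᵐ x ∂(mu d α), σ • x ∉ N := by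
    filter_upwards [ae_restrict_mem measurableSet_Ioi] with σ hσ
    have hq := quasiMeasurePreserving_smul (d := d) hα (Set.mem_Ioi.1 hσ)
    have h2 := measure_eq_zero_iff_ae_notMem.1 (hq.preimage_null hN0)
    simpa only [Set.mem_preimage] using h2
  have hmeas : Measurable fun p : ℝ × Space d => p.1 • p.2 := measurable_smul
  have hset : MeasurableSet {p : ℝ × Space d | p.1 • p.2 ∉ N} := hmeas hN.compl
  have h2 : ∀ᵐ x ∂(mu d α), ∀ᵐ σ ∂(volume.restrict (Set.Ioi (0 : ℝ))), σ • x ∉ N :=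
    (Measure.ae_ae_comm hset).1 h1
  filter_upwards [hm, h2] with x hx hx2
  refine Eq.trans (integral_congr_ae (hx2.mono fun σ hσ => ?_)) hx
  have : m (σ • x) = n (σ • x) := by
    by_contra hne
    exact hσ (hsub hne)
  simp only [dilate, this]

end Dilation

/-! ### The truncated formula as a multiplier, and the limit. -/

section Calderon

variable {d : ℕ} {α : ℝ}

/-- The truncated admissibility integral `∫_γ^δ |m(σ l)|² dσ/σ`. -/
def truncation (m : Space d → ℂ) (γ δ : ℝ) (l : Space d) : ℝ :=
  ∫ σ in Set.Ioc γ δ, ‖dilate m σ l‖ ^ 2 / σ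

/-- The two transforms are `m_σ F φ` and `conj m_σ`, whose product is `|m_σ|² F φ`. The bound on `m`
keeps `m_σ F φ` in `L²`, so `toL2` does not return its default value `0`. -/
theorem calderonIntegrand_eq (hα : -(1 / 2 : ℝ) < α) {m : Space d → ℂ} {M : ℝ}
    (hm2 : MemLp m 2 (mu d α)) (hM : ∀ x, ‖m x‖ ≤ M) (φ : Space d → ℂ) {σ : ℝ} (hσ : 0 < σ)
    (x : Space d) :
    calderonIntegrand α m φ x σ = ∫ l, ((‖dilate m σ l‖ ^ 2 / σ : ℝ) : ℂ) *
      transformL2 d α (toL2 α φ) l * starRingEnd ℂ (kernel α l x) ∂(mu d α) := by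
  have hd := memLp_dilate hα hσ hm2
  have h1 : MemLp (fun l => dilate m σ l * transformL2 d α (toL2 α φ) l) 2 (mu d α) := by
    refine ((Lp.memLp (transformL2 d α (toL2 α φ))).norm.const_mul M).mono
      (hd.1.mul (Lp.memLp _).1) (.of_forall fun l => ?_)
    rw [norm_mul, norm_mul, norm_norm]
    gcongr
    exact (hM _).trans (le_abs_self _)
  have h2 : MemLp (fun l => starRingEnd ℂ (dilate m σ l)) 2 (mu d α) := hd.star
  rw [calderonIntegrand, conv_eq_integral_transformL2 hα, multiplierOp, dualWavelet,
    LinearIsometryEquiv.apply_symm_apply, LinearIsometryEquiv.apply_symm_apply, ← integral_div]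
  refine integral_congr_ae ?_
  filter_upwards [coeFn_toL2 h1, coeFn_toL2 h2] with l e1 e2
  rw [e1, e2]
  have h3 : dilate m σ l * starRingEnd ℂ (dilate m σ l) = ((‖dilate m σ l‖ ^ 2 : ℝ) : ℂ) := by
    rw [Complex.mul_conj, Complex.normSq_eq_norm_sq]
  rw [Complex.ofReal_div, ← h3]
  ring

theorem measurable_dilate_uncurry {m : Space d → ℂ} (hm : Measurable m) :
    Measurable fun p : ℝ × Space d => dilate m p.1 p.2 :=
  hm.comp measurable_smul

theorem integrable_norm_dilate_sq (hα : -(1 / 2 : ℝ) < α) {m : Space d → ℂ} (hm : Measurable m)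
    (hm2 : MemLp m 2 (mu d α)) {γ δ : ℝ} (hγ : 0 < γ) :
    Integrable (fun p : ℝ × Space d => ‖dilate m p.1 p.2‖ ^ 2)
      ((volume.restrict (Set.Ioc γ δ)).prod (mu d α)) := by
  have hmeas : Measurable fun p : ℝ × Space d => ‖dilate m p.1 p.2‖ ^ 2 :=
    (measurable_dilate_uncurry hm).norm.pow_const 2
  refine ⟨hmeas.aestronglyMeasurable, ?_⟩
  rw [hasFiniteIntegral_iff_enorm, lintegral_prod _ hmeas.enorm.aemeasurable]
  have h1 : ∀ σ ∈ Set.Ioc γ δ, ∫⁻ x, ‖‖dilate m σ x‖ ^ 2‖ₑ ∂(mu d α) =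
      ENNReal.ofReal (dilationConst d α σ) * ∫⁻ x, ‖‖m x‖ ^ 2‖ₑ ∂(mu d α) := fun σ hσ =>
    lintegral_smul_mu hα (hγ.trans hσ.1) (hm.norm.pow_const 2).enorm
  rw [setLIntegral_congr_fun measurableSet_Ioc h1]
  have h2 : ∫⁻ x, ‖‖m x‖ ^ 2‖ₑ ∂(mu d α) ≠ ∞ :=
    ((memLp_two_iff_integrable_sq_norm hm2.1).1 hm2).2.ne
  rw [lintegral_mul_const' _ _ h2]
  refine ENNReal.mul_lt_top ?_ h2.lt_top
  have h3 : IntegrableOn (dilationConst d α) (Set.Ioc γ δ) :=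
    ((continuousOn_dilationConst.mono fun σ hσ => hγ.trans_le hσ.1).integrableOn_Icc
      (a := γ) (b := δ)).mono_set Set.Ioc_subset_Icc_self
  exact (hasFiniteIntegral_iff_ofReal (.of_forall fun σ => dilationConst_nonneg σ)).1 h3.2

theorem integrable_truncation_integrand (hα : -(1 / 2 : ℝ) < α) {m : Space d → ℂ} {M : ℝ}
    (hm : Measurable m) (hm2 : MemLp m 2 (mu d α)) (hM : ∀ x, ‖m x‖ ≤ M) (ψ : L2 d α)
    {γ δ : ℝ} (hγ : 0 < γ) :
    Integrable (fun p : ℝ × Space d => ((‖dilate m p.1 p.2‖ ^ 2 / p.1 : ℝ) : ℂ) * ψ p.2)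
      ((volume.restrict (Set.Ioc γ δ)).prod (mu d α)) := by
  have h1 := integrable_norm_dilate_sq hα hm hm2 hγ (δ := δ)
  have h2 : Integrable (fun p : ℝ × Space d => ‖ψ p.2‖ ^ 2)
      ((volume.restrict (Set.Ioc γ δ)).prod (mu d α)) :=
    ((memLp_two_iff_integrable_sq_norm (Lp.memLp ψ).1).1 (Lp.memLp ψ)).comp_snd _
  have hmem : ∀ᵐ p ∂((volume.restrict (Set.Ioc γ δ)).prod (mu d α)), p.1 ∈ Set.Ioc γ δ :=
    Measure.quasiMeasurePreserving_fst.ae (ae_restrict_mem measurableSet_Ioc)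
  refine ((h1.add h2).const_mul (M / γ)).mono' ?_ (hmem.mono fun p hp => ?_)
  · have e1 : Measurable fun p : ℝ × Space d => ((‖dilate m p.1 p.2‖ ^ 2 / p.1 : ℝ) : ℂ) :=
      Complex.measurable_ofReal.comp
        (((measurable_dilate_uncurry hm).norm.pow_const 2).div measurable_fst)
    exact e1.aestronglyMeasurable.mul ((Lp.stronglyMeasurable ψ).comp_measurable
      measurable_snd).aestronglyMeasurable
  · have hp0 : 0 < p.1 := hγ.trans hp.1
    have hM0 : 0 ≤ M := (norm_nonneg _).trans (hM 0)
    rw [norm_mul, Complex.norm_real, Real.norm_eq_abs, abs_of_nonneg (by positivity)]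
    have hA : ‖dilate m p.1 p.2‖ ≤ M := hM _
    have hA0 := norm_nonneg (dilate m p.1 p.2)
    have hB0 := norm_nonneg (ψ p.2)
    simp only [Pi.add_apply]
    generalize ‖dilate m p.1 p.2‖ = A at *
    generalize ‖ψ p.2‖ = B at *
    -- One factor `A` is bounded by `M`; then `A * B ≤ A² + B²`, whose terms are integrable over
    -- `(γ, δ] × μ`.
    calc A ^ 2 / p.1 * B ≤ A ^ 2 / γ * B := by gcongr; exact hp.1.le
      _ = A / γ * (A * B) := by ring
      _ ≤ M / γ * (A ^ 2 + B ^ 2) := by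
        gcongr
        nlinarith [sq_nonneg (A - B)]

theorem integrable_calderon_kernel (hα : -(1 / 2 : ℝ) < α) {m : Space d → ℂ} {M : ℝ}
    (hm : Measurable m) (hm2 : MemLp m 2 (mu d α)) (hM : ∀ x, ‖m x‖ ≤ M) (ψ : L2 d α)
    {γ δ : ℝ} (hγ : 0 < γ) (x : Space d) :
    Integrable (fun p : ℝ × Space d => ((‖dilate m p.1 p.2‖ ^ 2 / p.1 : ℝ) : ℂ) * ψ p.2 *
      starRingEnd ℂ (kernel α p.2 x)) ((volume.restrict (Set.Ioc γ δ)).prod (mu d α)) := by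
  have hc : Continuous fun p : ℝ × Space d => kernel α p.2 x := by
    have := continuous_besselj hα
    unfold kernel
    fun_prop
  refine (integrable_truncation_integrand hα hm hm2 hM ψ hγ).mul_bdd (c := 1)
    hc.star.aestronglyMeasurable (.of_forall fun p => ?_)
  rw [RCLike.norm_conj]
  exact norm_kernel_le_one hα _ _

theorem intervalIntegrable_calderonIntegrand (hα : -(1 / 2 : ℝ) < α) {m : Space d → ℂ} {M : ℝ}
    (hm : Measurable m) (hm2 : MemLp m 2 (mu d α)) (hM : ∀ x, ‖m x‖ ≤ M) (φ : Space d → ℂ)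
    {γ δ : ℝ} (hγ : 0 < γ) (hδ : γ < δ) (x : Space d) :
    IntervalIntegrable (calderonIntegrand α m φ x) volume γ δ := by
  rw [intervalIntegrable_iff_integrableOn_Ioc_of_le hδ.le]
  refine IntegrableOn.congr_fun (integrable_calderon_kernel hα hm hm2 hM
    (transformL2 d α (toL2 α φ)) hγ x).integral_prod_left (fun σ hσ => ?_) measurableSet_Ioc
  exact (calderonIntegrand_eq hα hm2 hM φ (hγ.trans hσ.1) x).symm

/-- Fubini, licensed by `integrable_calderon_kernel`, performs the `σ`-integral first. -/
theorem calderon_eq (hα : -(1 / 2 : ℝ) < α) {m : Space d → ℂ} {M : ℝ}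
    (hm : Measurable m) (hm2 : MemLp m 2 (mu d α)) (hM : ∀ x, ‖m x‖ ≤ M) (φ : Space d → ℂ)
    {γ δ : ℝ} (hγ : 0 < γ) (hδ : γ < δ) (x : Space d) :
    calderon α m φ γ δ x = ∫ l, (truncation m γ δ l : ℂ) * transformL2 d α (toL2 α φ) l *
      starRingEnd ℂ (kernel α l x) ∂(mu d α) := by
  rw [calderon, intervalIntegral.integral_of_le hδ.le,
    setIntegral_congr_fun measurableSet_Ioc fun σ hσ =>
      calderonIntegrand_eq hα hm2 hM φ (hγ.trans hσ.1) x,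
    integral_integral_swap (integrable_calderon_kernel hα hm hm2 hM _ hγ x)]
  refine integral_congr_ae (.of_forall fun l => ?_)
  beta_reduce
  rw [integral_mul_const, integral_mul_const, truncation, integral_complex_ofReal]

/-- The Bochner integral of a non-integrable function is `0`, so the value `1` forces integrability.
-/
theorem Admissible.integrableOn {m : Space d → ℂ} {l : Space d}
    (h : ∫ σ in Set.Ioi (0 : ℝ), ‖dilate m σ l‖ ^ 2 / σ = 1) :
    IntegrableOn (fun σ => ‖dilate m σ l‖ ^ 2 / σ) (Set.Ioi 0) := by
  by_contra hn
  rw [integral_undef hn] at h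
  exact zero_ne_one h

theorem truncation_nonneg {m : Space d → ℂ} {γ δ : ℝ} (hγ : 0 < γ) (l : Space d) :
    0 ≤ truncation m γ δ l :=
  setIntegral_nonneg measurableSet_Ioc fun σ hσ =>
    div_nonneg (by positivity) (hγ.trans hσ.1).le

theorem truncation_le_one {m : Space d → ℂ} {γ δ : ℝ} (hγ : 0 < γ) {l : Space d}
    (h : ∫ σ in Set.Ioi (0 : ℝ), ‖dilate m σ l‖ ^ 2 / σ = 1) : truncation m γ δ l ≤ 1 := by
  rw [← h]
  refine setIntegral_mono_set (Admissible.integrableOn h) ?_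
    (LE.le.eventuallyLE fun σ hσ => hγ.trans hσ.1)
  exact (ae_restrict_iff' measurableSet_Ioi).2 (.of_forall fun σ hσ =>
    div_nonneg (by positivity) (le_of_lt hσ))

theorem tendsto_truncation {m : Space d → ℂ} {l : Space d}
    (h : ∫ σ in Set.Ioi (0 : ℝ), ‖dilate m σ l‖ ^ 2 / σ = 1) :
    Tendsto (fun p : ℝ × ℝ => truncation m p.1 p.2 l) (𝓝[>] (0 : ℝ) ×ˢ atTop) (𝓝 1) := by
  have hcover : AECover (volume.restrict (Set.Ioi (0 : ℝ))) (𝓝[>] (0 : ℝ) ×ˢ atTop)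
      fun p : ℝ × ℝ => Set.Ioc p.1 p.2 := by
    refine ⟨(ae_restrict_iff' measurableSet_Ioi).2 (.of_forall fun σ hσ => ?_),
      fun p => measurableSet_Ioc⟩
    have h1 : ∀ᶠ γ in 𝓝[>] (0 : ℝ), γ < σ := mem_nhdsWithin_of_mem_nhds (Iio_mem_nhds hσ)
    exact (h1.prod_mk (eventually_ge_atTop σ)).mono fun p hp => ⟨hp.1, hp.2⟩
  have h1 := hcover.integral_tendsto_of_countably_generated (Admissible.integrableOn h)
  rw [h] at h1
  refine h1.congr' ?_
  have h2 : ∀ᶠ γ in 𝓝[>] (0 : ℝ), 0 < γ := self_mem_nhdsWithin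
  refine (h2.prod_inl atTop).mono fun p hp => ?_
  dsimp only
  have hsub : Set.Ioc p.1 p.2 ⊆ Set.Ioi 0 := fun σ hσ => hp.trans hσ.1
  rw [Measure.restrict_restrict measurableSet_Ioc, Set.inter_eq_left.2 hsub, truncation]

/-- Membership in `L¹` is what allows the inversion formula to be used as a pointwise integral; it
comes from Fubini, while `L²` membership comes from admissibility. -/
theorem integrable_truncation_mul (hα : -(1 / 2 : ℝ) < α) {m : Space d → ℂ} {M : ℝ}
    (hm : Measurable m) (hm2 : MemLp m 2 (mu d α)) (hM : ∀ x, ‖m x‖ ≤ M) (ψ : L2 d α)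
    {γ δ : ℝ} (hγ : 0 < γ) :
    Integrable (fun l => (truncation m γ δ l : ℂ) * ψ l) (mu d α) := by
  refine (integrable_truncation_integrand hα hm hm2 hM ψ hγ (δ := δ)).integral_prod_right.congr
    (.of_forall fun l => ?_)
  dsimp only
  rw [truncation, ← integral_complex_ofReal]
  exact integral_mul_const (ψ l) fun σ => ((‖dilate m σ l‖ ^ 2 / σ : ℝ) : ℂ)

theorem memLp_truncation_mul (hα : -(1 / 2 : ℝ) < α) {m : Space d → ℂ} {M : ℝ}
    (hm : Measurable m) (hm2 : MemLp m 2 (mu d α)) (hM : ∀ x, ‖m x‖ ≤ M)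
    (hadm : Admissible α m) (ψ : L2 d α) {γ δ : ℝ} (hγ : 0 < γ) :
    MemLp (fun l => (truncation m γ δ l : ℂ) * ψ l) 2 (mu d α) := by
  refine (Lp.memLp ψ).mono (integrable_truncation_mul hα hm hm2 hM ψ hγ).1
    (hadm.mono fun l hl => ?_)
  rw [norm_mul, Complex.norm_real, Real.norm_eq_abs, abs_of_nonneg (truncation_nonneg hγ l)]
  exact mul_le_of_le_one_left (norm_nonneg _) (truncation_le_one hγ hl)

theorem calderon_ae_eq (hα : -(1 / 2 : ℝ) < α) {m : Space d → ℂ} {M : ℝ}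
    (hm : Measurable m) (hm2 : MemLp m 2 (mu d α)) (hM : ∀ x, ‖m x‖ ≤ M)
    (hadm : Admissible α m) (φ : Space d → ℂ) {γ δ : ℝ} (hγ : 0 < γ) (hδ : γ < δ) :
    calderon α m φ γ δ =ᵐ[mu d α] (transformL2 d α).symm
      (memLp_truncation_mul hα hm hm2 hM hadm (transformL2 d α (toL2 α φ)) hγ (δ := δ)).toLp := by
  have h := (memLp_truncation_mul hα hm hm2 hM hadm (transformL2 d α (toL2 α φ)) hγ
    (δ := δ)).coeFn_toLp
  refine ((transformL2_symm_ae_eq hα ((integrable_congr h).2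
    (integrable_truncation_mul hα hm hm2 hM _ hγ))).trans (.of_forall fun x => ?_)).symm
  beta_reduce
  rw [calderon_eq hα hm hm2 hM φ hγ hδ]
  exact integral_congr_ae (h.mono fun l hl => by beta_reduce; rw [hl])

/-- Plancherel moves the error to the transform side, where it is `(K - 1) F φ`. -/
theorem eLpNorm_calderon_sub (hα : -(1 / 2 : ℝ) < α) {m : Space d → ℂ} {M : ℝ}
    (hm : Measurable m) (hm2 : MemLp m 2 (mu d α)) (hM : ∀ x, ‖m x‖ ≤ M)
    (hadm : Admissible α m) {φ : Space d → ℂ} (hφ : MemLp φ 2 (mu d α)) {γ δ : ℝ} (hγ : 0 < γ)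
    (hδ : γ < δ) :
    eLpNorm (fun x => calderon α m φ γ δ x - φ x) 2 (mu d α) =
      eLpNorm (fun l => (truncation m γ δ l : ℂ) * transformL2 d α (toL2 α φ) l -
        transformL2 d α (toL2 α φ) l) 2 (mu d α) := by
  let ψ := transformL2 d α (toL2 α φ)
  have hK := memLp_truncation_mul hα hm hm2 hM hadm ψ hγ (δ := δ)
  have h1 : (fun x => calderon α m φ γ δ x - φ x) =ᵐ[mu d α]
      ((transformL2 d α).symm (hK.toLp - ψ) : L2 d α) := by
    rw [map_sub, LinearIsometryEquiv.symm_apply_apply]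
    filter_upwards [calderon_ae_eq hα hm hm2 hM hadm φ hγ hδ, coeFn_toL2 hφ,
      Lp.coeFn_sub ((transformL2 d α).symm hK.toLp) (toL2 α φ)] with x e1 e2 e3
    rw [e3, e1, Pi.sub_apply, e2]
  have h2 : (fun l => (truncation m γ δ l : ℂ) * ψ l - ψ l) =ᵐ[mu d α]
      (hK.toLp - ψ : L2 d α) := by
    filter_upwards [hK.coeFn_toLp, Lp.coeFn_sub hK.toLp ψ] with l e1 e2
    rw [e2, Pi.sub_apply, e1]
  rw [eLpNorm_congr_ae h1, eLpNorm_congr_ae h2, ← Lp.enorm_def, ← Lp.enorm_def]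
  exact (transformL2 d α).symm.toLinearIsometry.enorm_map _

/-- Dominated convergence: `|K - 1| ≤ 1` bounds the squared integrand by `|ψ|²`, and `K → 1` almost
everywhere. -/
theorem tendsto_eLpNorm_truncation (hα : -(1 / 2 : ℝ) < α) {m : Space d → ℂ} {M : ℝ}
    (hm : Measurable m) (hm2 : MemLp m 2 (mu d α)) (hM : ∀ x, ‖m x‖ ≤ M)
    (hadm : Admissible α m) (ψ : L2 d α) :
    Tendsto (fun p : ℝ × ℝ => eLpNorm (fun l => (truncation m p.1 p.2 l : ℂ) * ψ l - ψ l) 2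
      (mu d α)) (𝓝[>] (0 : ℝ) ×ˢ atTop) (𝓝 0) := by
  have h2 : ∀ᶠ γ in 𝓝[>] (0 : ℝ), 0 < γ := self_mem_nhdsWithin
  have hpos : ∀ᶠ p : ℝ × ℝ in 𝓝[>] (0 : ℝ) ×ˢ atTop, 0 < p.1 := h2.prod_inl atTop
  have key : Tendsto (fun p : ℝ × ℝ =>
      ∫⁻ l, ‖(truncation m p.1 p.2 l : ℂ) * ψ l - ψ l‖ₑ ^ (2 : ℝ) ∂(mu d α))
      (𝓝[>] (0 : ℝ) ×ˢ atTop) (𝓝 (∫⁻ _, 0 ∂(mu d α))) := by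
    refine tendsto_lintegral_filter_of_dominated_convergence' (fun l => ‖ψ l‖ₑ ^ (2 : ℝ)) ?_ ?_ ?_ ?_
    · refine hpos.mono fun p hp => ?_
      exact ((integrable_truncation_mul hα hm hm2 hM ψ hp).1.sub
        (Lp.memLp ψ).1).enorm.pow_const _
    · refine hpos.mono fun p hp => hadm.mono fun l hl => ?_
      gcongr
      rw [enorm_le_iff_norm_le, ← sub_one_mul, norm_mul, ← Complex.ofReal_one,
        ← Complex.ofReal_sub, Complex.norm_real, Real.norm_eq_abs]
      refine mul_le_of_le_one_left (norm_nonneg _) (abs_le.2 ⟨?_, ?_⟩)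
      · linarith [truncation_nonneg (m := m) hp l (δ := p.2)]
      · linarith [truncation_le_one hp hl (δ := p.2)]
    · have h3 := lintegral_rpow_enorm_lt_top_of_eLpNorm_lt_top (p := 2) (by norm_num) (by norm_num)
        (Lp.memLp ψ).2
      simpa using h3.ne
    · refine hadm.mono fun l hl => ?_
      have h3 : Tendsto (fun p : ℝ × ℝ => (truncation m p.1 p.2 l : ℂ) * ψ l - ψ l)
          (𝓝[>] (0 : ℝ) ×ˢ atTop) (𝓝 0) := by
        have h4 := (((Complex.continuous_ofReal.tendsto _).comp (tendsto_truncation hl)).mul_const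
          (ψ l)).sub_const (ψ l)
        simpa using h4
      have h5 := ((ENNReal.continuous_rpow_const (y := 2)).tendsto _).comp h3.enorm
      simp only [Function.comp_def] at h5
      simpa using h5
  rw [lintegral_zero] at key
  have h6 := ((ENNReal.continuous_rpow_const (y := 1 / 2)).tendsto 0).comp key
  simp only [Function.comp_def] at h6
  rw [ENNReal.zero_rpow_of_pos (by norm_num)] at h6
  refine h6.congr fun p => ?_
  rw [eLpNorm_eq_lintegral_rpow_enorm_toReal (by norm_num) (by norm_num)]
  simp

/-- A measurable representative cut off at its essential supremum. Joint measurability in `(σ, x)`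
and a bound valid for all dilates at once need a representative that is good everywhere. -/
theorem exists_measurable_bounded_ae_eq {m : Space d → ℂ} (hm : MemLp m ∞ (mu d α)) :
    ∃ (n : Space d → ℂ) (M : ℝ), Measurable n ∧ (∀ x, ‖n x‖ ≤ M) ∧ m =ᵐ[mu d α] n := by
  have h0 := hm.1.ae_eq_mk
  have hM : ∀ᵐ x ∂(mu d α), ‖m x‖ ≤ (eLpNormEssSup m (mu d α)).toReal := by
    have hfin : eLpNormEssSup m (mu d α) ≠ ∞ := by
      have := hm.2.ne
      rwa [eLpNorm_exponent_top] at this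
    filter_upwards [enorm_ae_le_eLpNormEssSup m (mu d α)] with x hx
    rw [← toReal_enorm]
    exact ENNReal.toReal_mono hfin hx
  set M := (eLpNormEssSup m (mu d α)).toReal
  have hmeas : Measurable (hm.1.mk m) := hm.1.stronglyMeasurable_mk.measurable
  have hs : MeasurableSet {x | ‖hm.1.mk m x‖ ≤ M} := measurableSet_le hmeas.norm measurable_const
  refine ⟨{x | ‖hm.1.mk m x‖ ≤ M}.indicator (hm.1.mk m), M, hmeas.indicator hs, fun x => ?_, ?_⟩
  · by_cases hx : x ∈ {x | ‖hm.1.mk m x‖ ≤ M}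
    · rw [Set.indicator_of_mem hx]; exact hx
    · rw [Set.indicator_of_notMem hx, norm_zero]; exact ENNReal.toReal_nonneg
  · filter_upwards [h0, hM] with x h1 h2
    rw [Set.indicator_of_mem (by rw [Set.mem_ofPred_eq, ← h1]; exact h2), h1]

end Calderon

end Weinstein

end

theorem theorem2p5 (d : ℕ) (α : ℝ) (hα : -(1 / 2 : ℝ) < α)
    (φ m : Weinstein.Space d → ℂ)
    (hφ : MemLp φ 2 (Weinstein.mu d α))
    (hm2 : MemLp m 2 (Weinstein.mu d α)) (hm : MemLp m ∞ (Weinstein.mu d α))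
    (hadm : Weinstein.Admissible α m) :
    (∀ γ δ : ℝ, 0 < γ → γ < δ →
      (∀ x : Weinstein.Space d, 0 < x.2 →
        (∀ σ ∈ Set.Icc γ δ, Weinstein.ConvConvergesAt α
          (Weinstein.multiplierOp α m σ φ) (Weinstein.dualWavelet α m σ) x) ∧
        IntervalIntegrable (Weinstein.calderonIntegrand α m φ x) volume γ δ) ∧
      MemLp (Weinstein.calderon α m φ γ δ) 2 (Weinstein.mu d α)) ∧
    Tendsto
      (fun p : ℝ × ℝ =>
        eLpNorm (fun x => Weinstein.calderon α m φ p.1 p.2 x - φ x) 2 (Weinstein.mu d α))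
      (𝓝[>] (0 : ℝ) ×ˢ atTop) (𝓝 0) := by
  obtain ⟨n, M, hn, hM, hmn⟩ := Weinstein.exists_measurable_bounded_ae_eq hm
  have hn2 := hm2.ae_eq hmn
  have hadm' := Weinstein.Admissible.congr hα hmn hadm
  refine ⟨fun γ δ hγ hδ => ⟨fun x _ => ⟨fun σ _ => ?_, ?_⟩, ?_⟩, ?_⟩
  · exact Weinstein.convConvergesAt hα (Lp.memLp _) (Lp.memLp _) x
  · refine (Weinstein.intervalIntegrable_calderonIntegrand hα hn hn2 hM φ hγ hδ x).congr
      fun σ hσ => ?_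
    rw [Set.uIoc_of_le hδ.le] at hσ
    exact (Weinstein.calderonIntegrand_congr hα (hγ.trans hσ.1) hmn φ x).symm
  · rw [Weinstein.calderon_congr hα hmn φ hγ hδ]
    exact (Lp.memLp _).ae_eq (Weinstein.calderon_ae_eq hα hn hn2 hM hadm' φ hγ hδ).symm
  · refine (Weinstein.tendsto_eLpNorm_truncation hα hn hn2 hM hadm'
      (Weinstein.transformL2 d α (Weinstein.toL2 α φ))).congr' ?_
    -- Eventually `γ < 1 < δ`, which secures `γ < δ` along the product filter.
    have h1 : ∀ᶠ γ in 𝓝[>] (0 : ℝ), γ ∈ Set.Ioo (0 : ℝ) 1 := Ioo_mem_nhdsGT one_pos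
    refine (h1.prod_mk (eventually_gt_atTop (1 : ℝ))).mono fun p hp => ?_
    have hp2 : p.1 < p.2 := hp.1.2.trans hp.2
    dsimp only
    rw [Weinstein.calderon_congr hα hmn φ hp.1.1 hp2,
      Weinstein.eLpNorm_calderon_sub hα hn hn2 hM hadm' hφ hp.1.1 hp2]
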